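/- Let $n\ge 2$, let $e_1,\dots,e_n$ be the standard basis of $\mathbb{R}^n$, and consider the root system of type $B_n$ with simple roots $\alpha_i=e_i-e_{i+1}$ $(1\le i<n)$ and $\alpha_n=e_n$, simple coroots $\alpha_i^\vee=2\alpha_i/(\alpha_i,\alpha_i)$, coroot lattice $R^\vee=\bigoplus_{i=1}^n\mathbb{Z}\alpha_i^\vee$, simple reflections $s_1,\dots,s_n$ and finite Weyl group $W=\langle s_1,\dots,s_n\rangle$. For $w\in W$ put $\mathrm{Mod}(w)=(\mathrm{Id}-w)R^\vee$. Write $[n]=\{1,\dots,n\}$ and, for $I\subseteq\mathbb{Z}$, $I-1=\{i-1\mid i\in I\}$. Let $\beta=(\beta_1\ge\dots\ge\beta_p\ge1)$ and $\gamma=(1\le\gamma_1\le\dots\le\gamma_q)$ be partitions (possibly empty) with $|\beta|+|\gamma|=n$. Put $j^\beta_k=\beta_1+\dots+\beta_{k-1}$ and $j^\gamma_k=\gamma_1+\dots+\gamma_{k-1}$ (so $j^\beta_1=j^\gamma_1=0$). Define $t_0=s_n$, $t_i=s_{n-i}t_{i-1}s_{n-i}$ for $1\le i\le n-1$, and $$w^\beta_k=s_{j^\beta_k+1}s_{j^\beta_k+2}\cdots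 s_{j^\beta_k+\beta_k-1},\qquad w^\gamma_k=t_{j^\gamma_k}\,s_{n-(j^\gamma_k+1)}s_{n-(j^\gamma_k+2)}\cdots s_{n-j^\gamma_{k+1}+1},$$ $$w_{\beta,\gamma}=w^\beta_1\cdots w^\beta_p\cdot w^\gamma_1\cdots w^\gamma_q .$$ Let $J_\beta=\bigcup_{k=1}^p\{j^\beta_k+1,\dots,j^\beta_k+\beta_k-1\}$, $I_\beta=\{j^\beta_k\mid 2\le k\le p\}\cup\{|\beta|\}$, $I_\gamma=\{n-j^\gamma_k\mid 1\le k\le q\}$. Let $\gamma_{1,0}=0$ and let $\gamma_{k,k-1}\in\{0,1\}$ be the residue of $\gamma_k+\gamma_{k-1}$ modulo $2$ for $2\le k\le q$. If $\beta_p\ge2$, write $\gcd(\beta_k,\beta_p-2)=\gcd(\beta_1,\dots,\beta_p,\beta_p-2)$. If $|\beta|=0$ or $|\gamma|=0$, then $\mathrm{Mod}(w_{\beta,\gamma})$ has a $\mathbb{Z}$-basis as follows (in each set, $i$ ranges over elements of $[n]$). 1. If $|\beta|=0$ and $\gamma_1\ge3$: put $\varepsilon=n$ if $\gamma_1$ is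 odd and $\varepsilon=n-1$ if $\gamma_1$ is even. A basis is $$\{2\alpha^\vee_{n-j^\gamma_k}+\gamma_{k,k-1}\alpha^\vee_{\varepsilon}\mid 2\le k\le q\}\cup\{2\alpha^\vee_{n-1},\ (\gamma_1\bmod 2)\alpha^\vee_{n-1}+\alpha^\vee_n\}$$ $$\cup\ \{-\alpha_i^\vee+\alpha_{i+1}^\vee\mid i\notin I_\gamma\cup(I_\gamma-1)\}\cup\{-\alpha_i^\vee+\alpha_{i+2}^\vee\mid i\in I_\gamma-1,\ i\ne n-1\}.$$ 2. If $|\beta|=0$ and $\gamma_1=2$: a basis is $$\{2\alpha^\vee_{n-j^\gamma_k}+\gamma_{k,k-1}\alpha^\vee_{n-1}\mid 2\le k\le q\}\cup\{2\alpha^\vee_{n-1},\ (\gamma_1\bmod 2)\alpha^\vee_{n-1}+\alpha^\vee_n\}$$ $$\cup\ \{-\alpha_i^\vee+\alpha_{i+1}^\vee\mid i\notin I_\gamma\cup(I_\gamma-1)\}\cup\{-\alpha_i^\vee+\alpha_{i+2}^\vee\mid i\in I_\gamma-1,\ i\ne n-1\}.$$ 3. If $|\beta|=0$, $\gamma_1=1$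 and $\gamma_2\ge2$: a basis is $$\{2\alpha^\vee_{n-j^\gamma_k}+\gamma_{k,k-1}\alpha^\vee_{n}\mid 1\le k\le q\}\cup\{-\alpha_i^\vee+\alpha_{i+1}^\vee\mid i\notin I_\gamma\cup(I_\gamma-1)\}$$ $$\cup\ \{-\alpha_i^\vee+\alpha_{i+2}^\vee\mid i\in I_\gamma-1,\ i\ne n-1\}.$$ 4. If $|\beta|=0$ and, for some $\ell$ with $2\le\ell<n$, $\gamma_k=1$ for all $1\le k\le\ell$ while $\gamma_{\ell+1}\ge2$: a basis is $$\{2\alpha^\vee_{n-j^\gamma_k}+\gamma_{k,k-1}\alpha^\vee_{n}\mid 1\le k\le q\}\cup\{-\alpha^\vee_{n-\ell-1}+\alpha^\vee_n\}$$ $$\cup\ \{-\alpha_i^\vee+\alpha_{i+1}^\vee\mid i\notin I_\gamma\cup(I_\gamma-1)\}\cup\{-\alpha_i^\vee+\alpha_{i+2}^\vee\mid i\in I_\gamma-1,\ i<n-\ell-1\}.$$ 5. If $|\beta|=0$ and $\gamma=(1,\dots,1)$: a basis is $\{2\alpha_i^\vee\mid i\in[n]\}$. 6. If $|\gamma|=0$,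 $\beta_p\ge2$ and $\gcd(\beta_k,\beta_p-2)\ge2$: a basis is $$\{\alpha_i^\vee-\alpha_{i+1}^\vee\mid i\in J_\beta\setminus(I_\beta-1)\}\cup\{\alpha_i^\vee-\alpha_{i+2}^\vee\mid i\in(I_\beta-1)\setminus\{n-1\}\}\cup\{\gcd(\beta_k,\beta_p-2)\,\alpha^\vee_{n-1}\}.$$ 7. If $|\gamma|=0$, and either $\beta_p=1$, or $\beta_p\ge2$ and $\gcd(\beta_k,\beta_p-2)=1$: a basis is $\{\alpha_j^\vee\mid j\in J_\beta\}$. -/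

import Mathlib

open scoped InnerProductSpace

noncomputable section

namespace TypeB

/-! ### The root system of type `B_n` in `ℝ^n`

Everything is indexed by `1, ..., n`, as is usual for Dynkin diagrams; the special node is `n`. -/

/-- The Euclidean space `ℝ^n` in which the root system lives (identified with its dual). -/
abbrev V (n : ℕ) : Type := EuclideanSpace ℝ (Fin n)

/-- The standard basis vector `e_i`, for `1 ≤ i ≤ n` (and `0` for other `i`). -/
def stdVec (n i : ℕ) : V n := WithLp.toLp 2 (fun k : Fin n => if (k : ℕ) + 1 = i then 1 else 0)

/-- The simple roots of type `B_n`: `α_i = e_i - e_{i+1}` for `1 ≤ i < n`, and `α_n = e_n`. -/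
def simpleRoot (n i : ℕ) : V n := if i = n then stdVec n n else stdVec n i - stdVec n (i + 1)

/-- The simple coroots `α_i^∨ = 2 α_i / (α_i, α_i)`. -/
def simpleCoroot (n i : ℕ) : V n :=
  (2 / ⟪simpleRoot n i, simpleRoot n i⟫_ℝ) • simpleRoot n i

/-- The coroot lattice `R^∨`, generated by the simple coroots. -/
def corootLattice (n : ℕ) : Submodule ℤ (V n) :=
  Submodule.span ℤ (simpleCoroot n '' Set.Icc 1 n)

/-- The orthogonal reflection in the hyperplane orthogonal to `α_i`. -/
def rootReflection (n i : ℕ) : V n ≃ₗᵢ[ℝ] V n := (ℝ ∙ simpleRoot n i)ᗮ.reflection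

/-- The finite Weyl group of type `B_n`, generated by the simple reflections. -/
def weylGroup (n : ℕ) : Subgroup (V n ≃ₗᵢ[ℝ] V n) :=
  Subgroup.closure (rootReflection n '' Set.Icc 1 n)

open Classical in
/-- The simple reflection `s_i` as an element of the Weyl group, for `1 ≤ i ≤ n`
(and the identity for other `i`). -/
def s (n i : ℕ) : weylGroup n :=
  if h : i ∈ Set.Icc 1 n then
    ⟨rootReflection n i, Subgroup.subset_closure (Set.mem_image_of_mem _ h)⟩
  else 1

/-- The mod-set `Mod(w) = (Id - w) R^∨`. -/
def modSet {n : ℕ} (w : weylGroup n) : Submodule ℤ (V n) :=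
  (corootLattice n).map
    ((LinearMap.id - ((w : V n ≃ₗᵢ[ℝ] V n).toLinearEquiv : V n →ₗ[ℝ] V n)).restrictScalars ℤ)

/-- The set `S` is a `ℤ`-basis of the lattice `L`. -/
def IsZBasis {n : ℕ} (S : Set (V n)) (L : Submodule ℤ (V n)) : Prop :=
  LinearIndepOn ℤ id S ∧ Submodule.span ℤ S = L

/-! ### Partitions and conjugacy class representatives

A partition is a list of positive integers `(l_1, ..., l_p)`. -/

/-- Weakly decreasing partitions. -/
def IsDecPartition (l : List ℕ) : Prop := l.Pairwise (· ≥ ·) ∧ ∀ a ∈ l, 1 ≤ a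

/-- Weakly increasing partitions. -/
def IsIncPartition (l : List ℕ) : Prop := l.Pairwise (· ≤ ·) ∧ ∀ a ∈ l, 1 ≤ a

/-- The part `l_k`, for `1 ≤ k ≤ p`; by convention it is `0` if `k > p`. -/
def part (l : List ℕ) (k : ℕ) : ℕ := l.getD (k - 1) 0

/-- The partial sum `j_k = l_1 + ... + l_{k-1}`, for `1 ≤ k ≤ p + 1`. -/
def psum (l : List ℕ) (k : ℕ) : ℕ := (l.take (k - 1)).sum

/-- The positive block `w^β_k = s_{j_k + 1} s_{j_k + 2} ⋯ s_{j_k + (β_k - 1)}`. -/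
def wBetaBlock (n : ℕ) (β : List ℕ) (k : ℕ) : weylGroup n :=
  ((List.range' 1 (part β k - 1)).map fun i => s n (psum β k + i)).prod

/-- `w_β = w^β_1 ⋯ w^β_p`. -/
def wBeta (n : ℕ) (β : List ℕ) : weylGroup n :=
  ((List.range' 1 β.length).map (wBetaBlock n β)).prod

/-- `t_0 = s_n` and `t_i = s_{n-i} t_{i-1} s_{n-i}`. -/
def t (n : ℕ) : ℕ → weylGroup n
  | 0 => s n n
  | i + 1 => s n (n - (i + 1)) * t n i * s n (n - (i + 1))

/-- The negative block
`w^γ_k = t_{j_k} s_{n - (j_k + 1)} s_{n - (j_k + 2)} ⋯ s_{n - (j_k + (γ_k - 1))}`;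
the last index is `n - j_{k+1} + 1`. -/
def wGammaBlock (n : ℕ) (γ : List ℕ) (k : ℕ) : weylGroup n :=
  t n (psum γ k) * ((List.range' 1 (part γ k - 1)).map fun i => s n (n - (psum γ k + i))).prod

/-- `w_γ = w^γ_1 ⋯ w^γ_q`. -/
def wGamma (n : ℕ) (γ : List ℕ) : weylGroup n :=
  ((List.range' 1 γ.length).map (wGammaBlock n γ)).prod

/-- The conjugacy class representative `w_{β,γ} = w_β w_γ`. -/
def wRep (n : ℕ) (β γ : List ℕ) : weylGroup n := wBeta n β * wGamma n γ

/-! ### The index sets and numbers entering the bases -/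

/-- `J_β`, the union over `1 ≤ k ≤ p` of the intervals `{j_k + 1, ..., j_k + (β_k - 1)}`. -/
def J (β : List ℕ) : Set ℕ :=
  {i | ∃ k, 1 ≤ k ∧ k ≤ β.length ∧ psum β k + 1 ≤ i ∧ i ≤ psum β k + (part β k - 1)}

/-- `I_β = {j_k | 2 ≤ k ≤ p} ∪ {|β|}`. -/
def IBeta (β : List ℕ) : Set ℕ := {i | ∃ k, 2 ≤ k ∧ k ≤ β.length ∧ i = psum β k} ∪ {β.sum}

/-- `I_γ = {n - j_k | 1 ≤ k ≤ q}`. -/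
def IGamma (n : ℕ) (γ : List ℕ) : Set ℕ := {i | ∃ k, 1 ≤ k ∧ k ≤ γ.length ∧ i = n - psum γ k}

/-- `I - 1 = {i - 1 | i ∈ I}`. -/
def shift (I : Set ℕ) : Set ℕ := (fun i => i - 1) '' I

/-- `γ_{1,0} = 0`, and `γ_{k,k-1} = (γ_k + γ_{k-1}) mod 2` for `k ≥ 2`. -/
def jump (γ : List ℕ) (k : ℕ) : ℕ := if k ≤ 1 then 0 else (part γ k + part γ (k - 1)) % 2

/-- `gcd(β_1, ..., β_p, β_p - 2)`, used only if `β_p ≥ 2`. -/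
def gcdB (β : List ℕ) : ℕ := Nat.gcd (β.foldr Nat.gcd 0) (part β β.length - 2)

end TypeB

end

/-!
The representatives are signed permutations: on each block of `β`, `w_β` is a cycle of standard
basis vectors, and on each block of `γ`, `w_γ` is a cycle with one sign change (`act_wBeta_aux`,
`act_wGamma_aux`). To show that a set `S` spans `Mod(w)`, it suffices that an arbitrary additive map
`φ` out of `ℝ^n` kills `S` if and only if it kills `Mod(w)`.

The coroot lattice is generated by the differences `e_i - e_{i+1}` and `2 e_n`, so `φ` kills
`Mod(w)` if and only if all the values `φ(e_i - w e_i)` are equal to one element `ζ` with `2ζ = 0`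
(`modSet_le_ker_iff`). Telescoping over the blocks turns this into conditions on the simple coroots.
For `w_β`: `φ(α_i^∨) = ζ` for `i ∈ J_β`, and `β_k ζ = 0` for all `k` (`modSet_wBeta_le_ker_iff`).
For `w_γ`: `φ(α_i^∨) = ζ` for `i ∉ I_γ`, and `φ(2 e_b) = γ_k ζ` for the largest index `b` of the
`k`-th block (`modSet_wGamma_le_ker_iff`).

The differences of simple coroots in the proposed bases link all the `φ(α_i^∨)` in question in a
chain (`eq_of_chain`), and the remaining elements express `2ζ = 0` together with the condition on
the blocks: through `gcd(β_1, ..., β_p, 2) ζ = 0` in the case of `β` (`gcdB_nsmul_eq_zero_iff`), and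
from block to block, with the parity of `γ_k + γ_{k-1}` as increment, in the case of `γ`
(`forall_jump_iff`).

Linear independence is a matter of counting. The proposed bases are indexed by `J_β` or by `[n]`.
For `φ` with values in a real vector space `ζ = 0`, so that the real span of the basis contains the
simple coroots with the same indices, and these are linearly independent
(`linearIndepOn_id_of_simpleCoroot_mem`).
-/

open scoped InnerProductSpace

noncomputable section

namespace TypeB

/-! ### The action of the simple reflections -/

lemma stdVec_eq_single {n i : ℕ} (hi : i - 1 < n) (h1 : 1 ≤ i) :
    stdVec n i = EuclideanSpace.single ⟨i - 1, hi⟩ (1 : ℝ) := by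
  ext k
  simp only [stdVec, PiLp.single_apply, Fin.ext_iff]
  congr 1
  exact propext ⟨fun h => by omega, fun h => by omega⟩

lemma inner_stdVec {n i j : ℕ} (hi : i ∈ Set.Icc 1 n) (hj : j ∈ Set.Icc 1 n) :
    ⟪stdVec n i, stdVec n j⟫_ℝ = if i = j then 1 else 0 := by
  obtain ⟨hi1, hi2⟩ := hi
  obtain ⟨hj1, hj2⟩ := hj
  rw [stdVec_eq_single (by omega) hi1, stdVec_eq_single (by omega) hj1,
    EuclideanSpace.inner_single_left]
  simp only [PiLp.single_apply, Fin.ext_iff, map_one, one_mul]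
  congr 1
  exact propext ⟨fun h => by omega, fun h => by omega⟩

lemma simpleRoot_of_lt {n i : ℕ} (hi : i < n) :
    simpleRoot n i = stdVec n i - stdVec n (i + 1) := if_neg hi.ne

lemma simpleRoot_self (n : ℕ) : simpleRoot n n = stdVec n n := if_pos rfl

lemma inner_simpleRoot_of_lt {n i : ℕ} (h1 : 1 ≤ i) (hi : i < n) :
    ⟪simpleRoot n i, simpleRoot n i⟫_ℝ = 2 := by
  have hi' : i ∈ Set.Icc 1 n := ⟨h1, hi.le⟩
  have hi'' : i + 1 ∈ Set.Icc 1 n := ⟨by omega, hi⟩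
  rw [simpleRoot_of_lt hi]
  simp only [inner_sub_left, inner_sub_right, inner_stdVec hi' hi', inner_stdVec hi' hi'',
    inner_stdVec hi'' hi', inner_stdVec hi'' hi'']
  norm_num

lemma inner_simpleRoot_self {n : ℕ} (hn : 1 ≤ n) :
    ⟪simpleRoot n n, simpleRoot n n⟫_ℝ = 1 := by
  rw [simpleRoot_self, inner_stdVec ⟨hn, le_rfl⟩ ⟨hn, le_rfl⟩, if_pos rfl]

lemma simpleCoroot_of_lt {n i : ℕ} (h1 : 1 ≤ i) (hi : i < n) :
    simpleCoroot n i = stdVec n i - stdVec n (i + 1) := by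
  rw [simpleCoroot, inner_simpleRoot_of_lt h1 hi, simpleRoot_of_lt hi]
  norm_num

lemma simpleCoroot_self {n : ℕ} (hn : 1 ≤ n) : simpleCoroot n n = 2 • stdVec n n := by
  rw [simpleCoroot, inner_simpleRoot_self hn, simpleRoot_self, div_one, ofNat_smul_eq_nsmul]

lemma rootReflection_apply (n i : ℕ) (v : V n) :
    rootReflection n i v = v - ⟪simpleRoot n i, v⟫_ℝ • simpleCoroot n i := by
  rw [rootReflection, Submodule.reflection_orthogonal_apply, Submodule.reflection_singleton_apply,
    simpleCoroot, real_inner_self_eq_norm_sq, smul_smul, neg_sub]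
  congr 1
  simp only [RCLike.ofReal_real_eq_id, id, two_smul, ← add_smul]
  congr 1
  ring

lemma coe_s {n i : ℕ} (hi : i ∈ Set.Icc 1 n) :
    (s n i : V n ≃ₗᵢ[ℝ] V n) = rootReflection n i := by
  rw [s, dif_pos hi]

/-- The action of a Weyl group element on the `i`-th standard basis vector. -/
def act {n : ℕ} (w : weylGroup n) (i : ℕ) : V n := (w : V n ≃ₗᵢ[ℝ] V n) (stdVec n i)

lemma act_one {n : ℕ} (i : ℕ) : act (1 : weylGroup n) i = stdVec n i := rfl

lemma act_mul_of_eq {n i j : ℕ} (w w' : weylGroup n) (h : act w' i = stdVec n j) :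
    act (w * w') i = act w j := by
  change (w : V n ≃ₗᵢ[ℝ] V n) ((w' : V n ≃ₗᵢ[ℝ] V n) (stdVec n i)) = _
  rw [act] at h
  rw [h, act]

lemma act_mul_of_eq_neg {n i j : ℕ} (w w' : weylGroup n) (h : act w' i = -stdVec n j) :
    act (w * w') i = -act w j := by
  change (w : V n ≃ₗᵢ[ℝ] V n) ((w' : V n ≃ₗᵢ[ℝ] V n) (stdVec n i)) = _
  rw [act] at h
  rw [h, map_neg, act]

lemma inner_simpleRoot_stdVec {n i m : ℕ} (h1 : 1 ≤ i) (hi : i < n) (hm : m ∈ Set.Icc 1 n) :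
    ⟪simpleRoot n i, stdVec n m⟫_ℝ = (if i = m then 1 else 0) - if i + 1 = m then 1 else 0 := by
  rw [simpleRoot_of_lt hi, inner_sub_left, inner_stdVec ⟨h1, hi.le⟩ hm,
    inner_stdVec ⟨by omega, hi⟩ hm]

lemma act_s_left {n i : ℕ} (h1 : 1 ≤ i) (hi : i < n) : act (s n i) i = stdVec n (i + 1) := by
  rw [act, coe_s ⟨h1, hi.le⟩, rootReflection_apply, inner_simpleRoot_stdVec h1 hi ⟨h1, hi.le⟩,
    simpleCoroot_of_lt h1 hi]
  simp

lemma act_s_right {n i : ℕ} (h1 : 1 ≤ i) (hi : i < n) : act (s n i) (i + 1) = stdVec n i := by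
  rw [act, coe_s ⟨h1, hi.le⟩, rootReflection_apply,
    inner_simpleRoot_stdVec h1 hi ⟨by omega, by omega⟩, simpleCoroot_of_lt h1 hi]
  simp

lemma act_s_of_ne {n i m : ℕ} (h1 : 1 ≤ i) (hi : i < n) (hm : m ∈ Set.Icc 1 n) (h : m ≠ i)
    (h' : m ≠ i + 1) : act (s n i) m = stdVec n m := by
  rw [act, coe_s ⟨h1, hi.le⟩, rootReflection_apply, inner_simpleRoot_stdVec h1 hi hm]
  simp [h.symm, h'.symm]

lemma act_s_self {n : ℕ} (hn : 1 ≤ n) : act (s n n) n = -stdVec n n := by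
  rw [act, coe_s ⟨hn, le_rfl⟩, rootReflection_apply, simpleRoot_self,
    inner_stdVec ⟨hn, le_rfl⟩ ⟨hn, le_rfl⟩, simpleCoroot_self hn, if_pos rfl, one_smul, two_smul]
  abel

lemma act_s_self_of_ne {n m : ℕ} (hm : m ∈ Set.Icc 1 n) (h : m ≠ n) :
    act (s n n) m = stdVec n m := by
  have hn : 1 ≤ n := hm.1.trans hm.2
  rw [act, coe_s ⟨hn, le_rfl⟩, rootReflection_apply, simpleRoot_self,
    inner_stdVec ⟨hn, le_rfl⟩ hm, if_neg h.symm, zero_smul, sub_zero]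

/-- `t_c` is the reflection in the hyperplane orthogonal to `e_{n-c}`. -/
lemma act_t {n c : ℕ} (hc : c < n) : act (t n c) (n - c) = -stdVec n (n - c) ∧
    ∀ m ∈ Set.Icc 1 n, m ≠ n - c → act (t n c) m = stdVec n m := by
  induction c with
  | zero => exact ⟨act_s_self (by omega), fun m hm h => act_s_self_of_ne hm h⟩
  | succ c ih =>
    obtain ⟨ih1, ih2⟩ := ih (by omega)
    obtain ⟨i, hi⟩ : ∃ i, n - (c + 1) = i := ⟨_, rfl⟩
    have hi' : n - c = i + 1 := by omega
    rw [hi'] at ih1 ih2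
    rw [t, hi]
    have h1 : 1 ≤ i := by omega
    have h2 : i < n := by omega
    refine ⟨?_, fun m hm h => ?_⟩
    · rw [act_mul_of_eq _ _ (act_s_left h1 h2), act_mul_of_eq_neg _ _ ih1, act_s_right h1 h2]
    · by_cases h' : m = i + 1
      · subst h'
        rw [act_mul_of_eq _ _ (act_s_right h1 h2),
          act_mul_of_eq _ _ (ih2 i ⟨h1, h2.le⟩ (by omega)), act_s_left h1 h2]
      · rw [act_mul_of_eq _ _ (act_s_of_ne h1 h2 hm h h'), act_mul_of_eq _ _ (ih2 m hm h'),
          act_s_of_ne h1 h2 hm h h']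

/-- `s_{c+1} ⋯ s_{c+l}` is the cycle `e_{c+1} ↦ e_{c+2} ↦ ⋯ ↦ e_{c+l+1} ↦ e_{c+1}`. -/
lemma act_prod_s_add {n c l : ℕ} (h : c + l < n) :
    let w := ((List.range' 1 l).map fun i => s n (c + i)).prod
    (∀ m, c + 1 ≤ m → m ≤ c + l → act w m = stdVec n (m + 1)) ∧
    act w (c + l + 1) = stdVec n (c + 1) ∧
    ∀ m ∈ Set.Icc 1 n, (m ≤ c ∨ c + l + 1 < m) → act w m = stdVec n m := by
  induction l with
  | zero => exact ⟨fun m h1 h2 => by omega, by simp [act_one], fun m _ _ => by simp [act_one]⟩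
  | succ l ih =>
    obtain ⟨ih1, ih2, ih3⟩ := ih (by omega)
    simp only [List.range'_1_concat, List.map_append, List.prod_append, List.map_cons,
      List.map_nil, List.prod_singleton]
    have h1 : 1 ≤ c + (1 + l) := by omega
    have h2 : c + (1 + l) < n := by omega
    refine ⟨fun m hm hm' => ?_, ?_, fun m hm hm' => ?_⟩
    · by_cases hml : m = c + (1 + l)
      · subst hml
        rw [act_mul_of_eq _ _ (act_s_left h1 h2), ih3 _ ⟨by omega, by omega⟩ (by omega)]
      · rw [act_mul_of_eq _ _ (act_s_of_ne h1 h2 ⟨by omega, by omega⟩ hml (by omega)),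
          ih1 m hm (by omega)]
    · rw [show c + (l + 1) + 1 = c + (1 + l) + 1 by omega, act_mul_of_eq _ _ (act_s_right h1 h2),
        show c + (1 + l) = c + l + 1 by omega, ih2]
    · rw [act_mul_of_eq _ _ (act_s_of_ne h1 h2 hm (by omega) (by omega)), ih3 m hm (by omega)]

/-- `s_{b-1} ⋯ s_{b-l}`, with `b = n - c`, is the cycle
`e_b ↦ e_{b-1} ↦ ⋯ ↦ e_{b-l} ↦ e_b`. -/
lemma act_prod_s_sub {n c l : ℕ} (h : c + l < n) :
    let w := ((List.range' 1 l).map fun i => s n (n - (c + i))).prod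
    (∀ m, n - (c + l) < m → m ≤ n - c → act w m = stdVec n (m - 1)) ∧
    act w (n - (c + l)) = stdVec n (n - c) ∧
    ∀ m ∈ Set.Icc 1 n, (m < n - (c + l) ∨ n - c < m) → act w m = stdVec n m := by
  induction l with
  | zero => exact ⟨fun m h1 h2 => by omega, by simp [act_one], fun m _ _ => by simp [act_one]⟩
  | succ l ih =>
    obtain ⟨ih1, ih2, ih3⟩ := ih (by omega)
    simp only [List.range'_1_concat, List.map_append, List.prod_append, List.map_cons,
      List.map_nil, List.prod_singleton]
    obtain ⟨a, ha⟩ : ∃ a, n - (c + (1 + l)) = a := ⟨_, rfl⟩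
    have ha' : n - (c + l) = a + 1 := by omega
    have ha'' : n - (c + (l + 1)) = a := by omega
    rw [ha'] at ih1 ih2 ih3
    rw [ha, ha'']
    have h1 : 1 ≤ a := by omega
    have h2 : a < n := by omega
    refine ⟨fun m hm hm' => ?_, ?_, fun m hm hm' => ?_⟩
    · by_cases hml : m = a + 1
      · subst hml
        rw [act_mul_of_eq _ _ (act_s_right h1 h2), ih3 _ ⟨by omega, by omega⟩ (by omega)]
        rfl
      · rw [act_mul_of_eq _ _ (act_s_of_ne h1 h2 ⟨by omega, by omega⟩ (by omega) hml),
          ih1 m (by omega) hm']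
    · rw [act_mul_of_eq _ _ (act_s_left h1 h2), ih2]
    · rw [act_mul_of_eq _ _ (act_s_of_ne h1 h2 hm (by omega) (by omega)), ih3 m hm (by omega)]

/-! ### Partial sums of a partition -/

lemma psum_one (l : List ℕ) : psum l 1 = 0 := rfl

lemma psum_succ (l : List ℕ) {k : ℕ} (hk : 1 ≤ k) : psum l (k + 1) = psum l k + part l k := by
  obtain ⟨k, rfl⟩ : ∃ j, k = j + 1 := ⟨k - 1, by omega⟩
  simp only [psum, part, Nat.add_sub_cancel]
  rcases lt_or_ge k l.length with h | h
  · rw [List.take_add_one, List.sum_append, List.getElem?_eq_getElem h]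
    simp [h]
  · rw [List.take_of_length_le h, List.take_of_length_le (by omega), List.getD_eq_default _ _ h,
      add_zero]

lemma psum_mono (l : List ℕ) : Monotone (psum l) := by
  refine monotone_nat_of_le_succ fun k => ?_
  rcases Nat.eq_zero_or_pos k with rfl | hk
  · rfl
  · rw [psum_succ l hk]; omega

lemma psum_length_succ (l : List ℕ) : psum l (l.length + 1) = l.sum := by simp [psum]

lemma part_mem {l : List ℕ} {k : ℕ} (h1 : 1 ≤ k) (h2 : k ≤ l.length) : part l k ∈ l := by
  rw [part, List.getD_eq_getElem _ _ (by omega)]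
  exact List.getElem_mem _

lemma psum_succ_le_sum (l : List ℕ) {k : ℕ} (h2 : k ≤ l.length) :
    psum l (k + 1) ≤ l.sum := psum_length_succ l ▸ psum_mono l (by omega)

lemma exists_block (l : List ℕ) {c : ℕ} (hc : c < l.sum) :
    ∃ k, 1 ≤ k ∧ k ≤ l.length ∧ psum l k ≤ c ∧ c < psum l (k + 1) := by
  have hex : ∃ k, c < psum l (k + 1) := ⟨l.length, by rwa [psum_length_succ]⟩
  have hk := Nat.find_spec hex
  have hk1 : 1 ≤ Nat.find hex := by
    by_contra h
    rw [show Nat.find hex = 0 by omega, zero_add, psum_one] at hk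
    omega
  refine ⟨Nat.find hex, hk1, Nat.find_min' hex (by rwa [psum_length_succ]), ?_, hk⟩
  have := Nat.find_min hex (m := Nat.find hex - 1) (by omega)
  rw [Nat.sub_add_cancel hk1] at this
  omega

/-! ### The representatives as signed permutations -/

/-- The product `w^β_1 ⋯ w^β_r` is the cycle
`e_{j_k+1} ↦ e_{j_k+2} ↦ ⋯ ↦ e_{j_{k+1}} ↦ e_{j_k+1}` on the `k`-th block for `k ≤ r`, and fixes the
later basis vectors. -/
lemma act_wBeta_aux {n : ℕ} {β : List ℕ} (hβ : ∀ a ∈ β, 1 ≤ a) (hsum : β.sum ≤ n) {r : ℕ}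
    (hr : r ≤ β.length) :
    let w := ((List.range' 1 r).map (wBetaBlock n β)).prod
    (∀ k, 1 ≤ k → k ≤ r →
      (∀ m, psum β k + 1 ≤ m → m < psum β (k + 1) → act w m = stdVec n (m + 1)) ∧
      act w (psum β (k + 1)) = stdVec n (psum β k + 1)) ∧
    ∀ m, psum β (r + 1) < m → m ≤ n → act w m = stdVec n m := by
  induction r with
  | zero => exact ⟨fun k h1 h2 => by omega, fun m _ _ => by simp [act_one]⟩
  | succ r ih =>
    obtain ⟨ih1, ih2⟩ := ih (by omega)
    simp only [List.range'_1_concat, List.map_append, List.prod_append, List.map_cons,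
      List.map_nil, List.prod_singleton]
    have hs := psum_succ β (k := r + 1) (by omega)
    have hp := hβ _ (part_mem (l := β) (k := r + 1) (by omega) hr)
    have hle := psum_succ_le_sum β hr
    obtain ⟨B1, B2, B3⟩ := act_prod_s_add (n := n) (c := psum β (r + 1))
      (l := part β (r + 1) - 1) (by omega)
    rw [show 1 + r = r + 1 by omega, wBetaBlock]
    refine ⟨fun k hk1 hk2 => ?_, fun m hm hm' => ?_⟩
    · rcases Nat.lt_or_ge r k with h | h
      · obtain rfl : k = r + 1 := by omega
        refine ⟨fun m hm hm' => ?_, ?_⟩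
        · rw [act_mul_of_eq _ _ (B1 m hm (by omega)), ih2 _ (by omega) (by omega)]
        · rw [show psum β (r + 1) + (part β (r + 1) - 1) + 1 = psum β (r + 1 + 1) by omega] at B2
          rw [act_mul_of_eq _ _ B2, ih2 _ (by omega) (by omega)]
      · obtain ⟨ih3, ih4⟩ := ih1 k hk1 h
        have hm1 := psum_mono β (show k + 1 ≤ r + 1 by omega)
        have hs' := psum_succ β hk1
        have hp' := hβ _ (part_mem (l := β) hk1 (by omega))
        refine ⟨fun m hm hm' => ?_, ?_⟩
        · rw [act_mul_of_eq _ _ (B3 m ⟨by omega, by omega⟩ (by omega)), ih3 m hm hm']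
        · rw [act_mul_of_eq _ _ (B3 _ ⟨by omega, by omega⟩ (by omega)), ih4]
    · rw [act_mul_of_eq _ _ (B3 m ⟨by omega, by omega⟩ (by omega)), ih2 m (by omega) hm']

/-- The product `w^γ_1 ⋯ w^γ_r` is the signed cycle `e_b ↦ e_{b-1} ↦ ⋯ ↦ e_a ↦ -e_b` on the `k`-th
block for `k ≤ r`, where `b = n - j_k` and `a = n - j_{k+1} + 1`, and fixes the basis vectors with
smaller indices. -/
lemma act_wGamma_aux {n : ℕ} {γ : List ℕ} (hγ : ∀ a ∈ γ, 1 ≤ a) (hsum : γ.sum ≤ n) {r : ℕ}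
    (hr : r ≤ γ.length) :
    let w := ((List.range' 1 r).map (wGammaBlock n γ)).prod
    (∀ k, 1 ≤ k → k ≤ r →
      (∀ m, n - psum γ (k + 1) + 1 < m → m ≤ n - psum γ k → act w m = stdVec n (m - 1)) ∧
      act w (n - psum γ (k + 1) + 1) = -stdVec n (n - psum γ k)) ∧
    ∀ m, 1 ≤ m → m ≤ n - psum γ (r + 1) → act w m = stdVec n m := by
  induction r with
  | zero => exact ⟨fun k h1 h2 => by omega, fun m _ _ => by simp [act_one]⟩
  | succ r ih =>
    obtain ⟨ih1, ih2⟩ := ih (by omega)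
    simp only [List.range'_1_concat, List.map_append, List.prod_append, List.map_cons,
      List.map_nil, List.prod_singleton]
    have hs := psum_succ γ (k := r + 1) (by omega)
    have hp := hγ _ (part_mem (l := γ) (k := r + 1) (by omega) hr)
    have hle := psum_succ_le_sum γ hr
    obtain ⟨B1, B2, B3⟩ := act_prod_s_sub (n := n) (c := psum γ (r + 1))
      (l := part γ (r + 1) - 1) (by omega)
    obtain ⟨T1, T2⟩ := act_t (n := n) (c := psum γ (r + 1)) (by omega)
    have hb : n - (psum γ (r + 1) + (part γ (r + 1) - 1)) = n - psum γ (r + 1 + 1) + 1 := by omega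
    rw [hb] at B1 B2 B3
    -- the action of the last block
    have C1 : ∀ m, n - psum γ (r + 1 + 1) + 1 < m → m ≤ n - psum γ (r + 1) →
        act (wGammaBlock n γ (r + 1)) m = stdVec n (m - 1) := fun m hm hm' => by
      rw [wGammaBlock, act_mul_of_eq _ _ (B1 m hm hm'), T2 _ ⟨by omega, by omega⟩ (by omega)]
    have C2 : act (wGammaBlock n γ (r + 1)) (n - psum γ (r + 1 + 1) + 1) =
        -stdVec n (n - psum γ (r + 1)) := by
      rw [wGammaBlock, act_mul_of_eq _ _ B2, T1]
    have C3 : ∀ m ∈ Set.Icc 1 n, (m < n - psum γ (r + 1 + 1) + 1 ∨ n - psum γ (r + 1) < m) →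
        act (wGammaBlock n γ (r + 1)) m = stdVec n m := fun m hm hm' => by
      rw [wGammaBlock, act_mul_of_eq _ _ (B3 m hm hm'), T2 _ hm (by omega)]
    rw [show 1 + r = r + 1 by omega]
    refine ⟨fun k hk1 hk2 => ?_, fun m hm hm' => ?_⟩
    · rcases Nat.lt_or_ge r k with h | h
      · obtain rfl : k = r + 1 := by omega
        refine ⟨fun m hm hm' => ?_, ?_⟩
        · rw [act_mul_of_eq _ _ (C1 m hm hm'), ih2 _ (by omega) (by omega)]
        · rw [act_mul_of_eq_neg _ _ C2, ih2 _ (by omega) (by omega)]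
      · obtain ⟨ih3, ih4⟩ := ih1 k hk1 h
        have hm1 := psum_mono γ (show k + 1 ≤ r + 1 by omega)
        have hs' := psum_succ γ hk1
        have hp' := hγ _ (part_mem (l := γ) hk1 (by omega))
        refine ⟨fun m hm hm' => ?_, ?_⟩
        · rw [act_mul_of_eq _ _ (C3 m ⟨by omega, by omega⟩ (by omega)), ih3 m hm hm']
        · rw [act_mul_of_eq _ _ (C3 _ ⟨by omega, by omega⟩ (by omega)), ih4]
    · rw [act_mul_of_eq _ _ (C3 m ⟨by omega, by omega⟩ (by omega)), ih2 m hm (by omega)]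

lemma eq_nil_of_sum_eq_zero {l : List ℕ} (h : ∀ a ∈ l, 1 ≤ a) (h0 : l.sum = 0) : l = [] := by
  cases l with
  | nil => rfl
  | cons a l => have := h a (by simp); simp at h0; omega

/-! ### Testing mod-sets on additive maps -/

section Test

variable {Q : Type*} [AddCommGroup Q]

lemma map_simpleCoroot_of_lt {n : ℕ} (φ : V n →ₗ[ℤ] Q) {i : ℕ} (h1 : 1 ≤ i) (hi : i < n) :
    φ (simpleCoroot n i) = φ (stdVec n i) - φ (stdVec n (i + 1)) := by
  rw [simpleCoroot_of_lt h1 hi, map_sub]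

lemma map_simpleCoroot_self {n : ℕ} (φ : V n →ₗ[ℤ] Q) (hn : 1 ≤ n) :
    φ (simpleCoroot n n) = 2 • φ (stdVec n n) := by
  rw [simpleCoroot_self hn, map_nsmul]

/-- An additive map kills `Mod(w)` if and only if it takes one and the same value `ζ`, with
`2ζ = 0`, on all the vectors `e_i - w e_i`: it has to kill their differences for neighbouring `i`
and twice the last of them. -/
lemma modSet_le_ker_iff {n : ℕ} (hn : 1 ≤ n) (w : weylGroup n) (φ : V n →ₗ[ℤ] Q) :
    modSet w ≤ LinearMap.ker φ ↔
      ∃ ζ : Q, 2 • ζ = 0 ∧ ∀ i ∈ Set.Icc 1 n, φ (stdVec n i) - φ (act w i) = ζ := by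
  have key : modSet w ≤ LinearMap.ker φ ↔ ∀ i ∈ Set.Icc 1 n,
      φ (simpleCoroot n i - (w : V n ≃ₗᵢ[ℝ] V n) (simpleCoroot n i)) = 0 := by
    rw [modSet, Submodule.map_le_iff_le_comap, corootLattice, Submodule.span_le,
      Set.image_subset_iff]
    rfl
  have hlt : ∀ i, 1 ≤ i → i < n →
      φ (simpleCoroot n i - (w : V n ≃ₗᵢ[ℝ] V n) (simpleCoroot n i)) =
      (φ (stdVec n i) - φ (act w i)) - (φ (stdVec n (i + 1)) - φ (act w (i + 1))) := by
    intro i h1 hi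
    simp only [simpleCoroot_of_lt h1 hi, map_sub, act]
    abel
  have hself : φ (simpleCoroot n n - (w : V n ≃ₗᵢ[ℝ] V n) (simpleCoroot n n)) =
      2 • (φ (stdVec n n) - φ (act w n)) := by
    simp only [simpleCoroot_self hn, map_sub, map_nsmul, act, nsmul_sub]
  rw [key]
  constructor
  · intro h
    refine ⟨_, hself ▸ h n ⟨hn, le_rfl⟩, fun i hi => ?_⟩
    induction hi.2 using Nat.decreasingInduction with
    | self => rfl
    | of_succ k hk ih =>
      rcases Nat.eq_zero_or_pos k with rfl | hk1
      · exact absurd hi.1 (by omega)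
      · rw [← ih ⟨by omega, hk⟩]
        exact sub_eq_zero.mp (hlt k hk1 hk ▸ h k ⟨hk1, hk.le⟩)
  · rintro ⟨ζ, h2, h⟩ i ⟨h1, hi⟩
    rcases hi.eq_or_lt with rfl | hi
    · rw [hself, h _ ⟨h1, le_rfl⟩, h2]
    · rw [hlt i h1 hi, h i ⟨h1, hi.le⟩, h (i + 1) ⟨by omega, hi⟩, sub_self]

lemma nsmul_congr_mod_two {ζ : Q} (h : 2 • ζ = 0) {a b : ℕ} (hab : a % 2 = b % 2) :
    a • ζ = b • ζ := by
  rw [← Nat.div_add_mod a 2, ← Nat.div_add_mod b 2, add_nsmul, add_nsmul, mul_comm, mul_nsmul',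
    h, mul_comm 2 (b / 2), mul_nsmul', h, hab, nsmul_zero, nsmul_zero]

lemma neg_eq_self_of_two_nsmul {ζ : Q} (h : 2 • ζ = 0) : -ζ = ζ :=
  neg_eq_of_add_eq_zero_left (by rw [← two_nsmul, h])

/-- Telescoping: if `φ` takes the value `ζ` on the simple coroots `α_a^∨, ..., α_{b-1}^∨`, then
`φ(e_a) = φ(e_b) + (b - a) ζ`. -/
lemma map_stdVec_eq {n : ℕ} (φ : V n →ₗ[ℤ] Q) {ζ : Q} {a b : ℕ} (ha : 1 ≤ a) (hab : a ≤ b)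
    (hb : b ≤ n) (h : ∀ i, a ≤ i → i < b → φ (simpleCoroot n i) = ζ) :
    φ (stdVec n a) = φ (stdVec n b) + (b - a) • ζ := by
  induction b, hab using Nat.le_induction with
  | base => simp
  | succ b hab ih =>
    have h1 := h b hab (by omega)
    rw [map_simpleCoroot_of_lt φ (by omega) (by omega)] at h1
    rw [ih (by omega) fun i hi hi' => h i hi (by omega), Nat.succ_sub hab, Nat.succ_eq_add_one,
      succ_nsmul, ← h1]
    abel

lemma mem_J_iff {β : List ℕ} (hβ : ∀ a ∈ β, 1 ≤ a) {i : ℕ} :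
    i ∈ J β ↔ ∃ k, 1 ≤ k ∧ k ≤ β.length ∧ psum β k + 1 ≤ i ∧ i < psum β (k + 1) := by
  refine exists_congr fun k => and_congr_right fun h1 => and_congr_right fun h2 =>
    and_congr_right fun _ => ?_
  have := psum_succ β h1
  have := hβ _ (part_mem h1 h2)
  omega

lemma J_subset {n : ℕ} {β : List ℕ} (hβ : ∀ a ∈ β, 1 ≤ a) (hsum : β.sum = n) :
    ∀ i ∈ J β, 1 ≤ i ∧ i < n := by
  intro i hi
  obtain ⟨k, h1, h2, h3, h4⟩ := (mem_J_iff hβ).mp hi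
  have := psum_succ_le_sum β h2
  omega

/-- An additive map kills `Mod(w_β)` if and only if it takes one and the same value `ζ` on all
`α_i^∨` with `i ∈ J_β`, where `ζ` is annihilated by `2` and by all parts of `β`. -/
lemma modSet_wBeta_le_ker_iff {n : ℕ} (hn : 1 ≤ n) {β : List ℕ} (hβ : ∀ a ∈ β, 1 ≤ a)
    (hsum : β.sum = n) (φ : V n →ₗ[ℤ] Q) :
    modSet (wBeta n β) ≤ LinearMap.ker φ ↔
      ∃ ζ : Q, 2 • ζ = 0 ∧ (∀ i ∈ J β, φ (simpleCoroot n i) = ζ) ∧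
        ∀ k, 1 ≤ k → k ≤ β.length → part β k • ζ = 0 := by
  have hact : ∀ k, 1 ≤ k → k ≤ β.length → _ := (act_wBeta_aux hβ hsum.le le_rfl).1
  change ∀ k, 1 ≤ k → k ≤ β.length →
      (∀ m, psum β k + 1 ≤ m → m < psum β (k + 1) → act (wBeta n β) m = stdVec n (m + 1)) ∧
      act (wBeta n β) (psum β (k + 1)) = stdVec n (psum β k + 1) at hact
  -- the last vector of a block gives the sum of the simple coroots of this block, up to sign
  have hlast : ∀ ζ : Q, (∀ i ∈ J β, φ (simpleCoroot n i) = ζ) →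
      ∀ k, 1 ≤ k → k ≤ β.length →
        φ (stdVec n (psum β (k + 1))) - φ (act (wBeta n β) (psum β (k + 1))) =
          ζ - part β k • ζ := by
    intro ζ h k hk1 hk2
    have h1 := psum_succ β hk1
    have h2 := hβ _ (part_mem hk1 hk2)
    have h3 := psum_succ_le_sum β hk2
    rw [(hact k hk1 hk2).2, map_stdVec_eq φ (ζ := ζ) (a := psum β k + 1) (b := psum β (k + 1))
      (by omega) (by omega) (by omega) fun i hi hi' =>
        h i ((mem_J_iff hβ).mpr ⟨k, hk1, hk2, hi, hi'⟩)]
    obtain ⟨d, hd⟩ : ∃ d, part β k = d + 1 := ⟨part β k - 1, by omega⟩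
    rw [show psum β (k + 1) - (psum β k + 1) = d by omega, hd, succ_nsmul]
    abel
  rw [modSet_le_ker_iff hn]
  refine exists_congr fun ζ => and_congr_right fun h2 => ⟨fun h => ?_, fun h i hi => ?_⟩
  · have hJ : ∀ i ∈ J β, φ (simpleCoroot n i) = ζ := by
      intro i hi
      have hin := J_subset hβ hsum i hi
      obtain ⟨k, hk1, hk2, hk3, hk4⟩ := (mem_J_iff hβ).mp hi
      rw [map_simpleCoroot_of_lt φ hin.1 hin.2, ← (hact k hk1 hk2).1 i hk3 hk4]
      exact h i ⟨hin.1, hin.2.le⟩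
    refine ⟨hJ, fun k hk1 hk2 => ?_⟩
    have h1 := psum_succ β hk1
    have h2 := hβ _ (part_mem hk1 hk2)
    have h3 := psum_succ_le_sum β hk2
    have h4 := hlast ζ hJ k hk1 hk2
    rw [h _ ⟨by omega, by omega⟩] at h4
    exact sub_eq_self.mp h4.symm
  · obtain ⟨hJ, hk⟩ := h
    obtain ⟨k, hk1, hk2, hk3, hk4⟩ := exists_block β (c := i - 1) (by
      have := hi.1
      have := hi.2
      omega)
    have := hi.1
    rcases (show i ≤ psum β (k + 1) by omega).eq_or_lt with h4 | h4
    · rw [h4, hlast ζ hJ k hk1 hk2, hk k hk1 hk2, sub_zero]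
    · have hiJ : i ∈ J β := (mem_J_iff hβ).mpr ⟨k, hk1, hk2, by omega, h4⟩
      rw [(hact k hk1 hk2).1 i (by omega) h4,
        ← map_simpleCoroot_of_lt φ hi.1 (J_subset hβ hsum i hiJ).2, hJ i hiJ]

lemma notMem_IGamma {n : ℕ} {γ : List ℕ} {k i : ℕ} (h1 : n - psum γ (k + 1) < i)
    (h2 : i < n - psum γ k) : i ∉ IGamma n γ := by
  rintro ⟨j, -, -, rfl⟩
  rcases Nat.lt_or_ge k j with h | h
  · have := psum_mono γ (show k + 1 ≤ j from h); omega
  · have := psum_mono γ h; omega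

/-- The block of `w_γ` containing the index `i`. -/
lemma exists_block_sub {n : ℕ} {γ : List ℕ} (hsum : γ.sum = n) {i : ℕ} (hi : i ∈ Set.Icc 1 n) :
    ∃ k, 1 ≤ k ∧ k ≤ γ.length ∧ n - psum γ (k + 1) < i ∧ i ≤ n - psum γ k := by
  obtain ⟨h1, h2⟩ := hi
  obtain ⟨k, hk1, hk2, hk3, hk4⟩ := exists_block γ (c := n - i) (by omega)
  exact ⟨k, hk1, hk2, by omega, by omega⟩

/-- An additive map kills `Mod(w_γ)` if and only if there is a `ζ` with `2ζ = 0` such that the map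
takes the value `ζ` on all `α_i^∨` with `i ∉ I_γ`, and `γ_k ζ` on `2 e_b` for the largest index `b`
of the `k`-th block. -/
lemma modSet_wGamma_le_ker_iff {n : ℕ} (hn : 1 ≤ n) {γ : List ℕ} (hγ : ∀ a ∈ γ, 1 ≤ a)
    (hsum : γ.sum = n) (φ : V n →ₗ[ℤ] Q) :
    modSet (wGamma n γ) ≤ LinearMap.ker φ ↔
      ∃ ζ : Q, 2 • ζ = 0 ∧ (∀ i ∈ Set.Icc 1 n, i ∉ IGamma n γ → φ (simpleCoroot n i) = ζ) ∧
        ∀ k, 1 ≤ k → k ≤ γ.length → 2 • φ (stdVec n (n - psum γ k)) = part γ k • ζ := by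
  have hact : ∀ k, 1 ≤ k → k ≤ γ.length → _ := (act_wGamma_aux hγ hsum.le le_rfl).1
  change ∀ k, 1 ≤ k → k ≤ γ.length →
      (∀ m, n - psum γ (k + 1) + 1 < m → m ≤ n - psum γ k →
        act (wGamma n γ) m = stdVec n (m - 1)) ∧
      act (wGamma n γ) (n - psum γ (k + 1) + 1) = -stdVec n (n - psum γ k) at hact
  -- the first vector of a block gives `e_a + e_b = 2 e_b + α_a^∨ + ⋯ + α_{b-1}^∨`
  have hfirst : ∀ ζ : Q, 2 • ζ = 0 →
      (∀ i ∈ Set.Icc 1 n, i ∉ IGamma n γ → φ (simpleCoroot n i) = ζ) →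
      ∀ k, 1 ≤ k → k ≤ γ.length →
        φ (stdVec n (n - psum γ (k + 1) + 1)) - φ (act (wGamma n γ) (n - psum γ (k + 1) + 1)) =
          2 • φ (stdVec n (n - psum γ k)) - part γ k • ζ + ζ := by
    intro ζ h2 h k hk1 hk2
    have h1 := psum_succ γ hk1
    have h3 := hγ _ (part_mem hk1 hk2)
    have h4 := psum_succ_le_sum γ hk2
    rw [(hact k hk1 hk2).2, map_stdVec_eq φ (ζ := ζ) (a := n - psum γ (k + 1) + 1)
      (b := n - psum γ k) (by omega) (by omega) (by omega) fun i hi hi' =>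
        h i ⟨by omega, by omega⟩ (notMem_IGamma (by omega) hi')]
    obtain ⟨d, hd⟩ : ∃ d, part γ k = d + 1 := ⟨part γ k - 1, by omega⟩
    have h5 : d • ζ = -(d • ζ) := by
      rw [← smul_neg, neg_eq_self_of_two_nsmul h2]
    rw [show n - psum γ k - (n - psum γ (k + 1) + 1) = d by omega, hd, map_neg,
      two_nsmul, succ_nsmul]
    nth_rewrite 1 [h5]
    abel
  rw [modSet_le_ker_iff hn]
  refine exists_congr fun ζ => and_congr_right fun h2 => ⟨fun h => ?_, fun h i hi => ?_⟩
  · have hI : ∀ i ∈ Set.Icc 1 n, i ∉ IGamma n γ → φ (simpleCoroot n i) = ζ := by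
      intro i hi hi'
      obtain ⟨k, hk1, hk2, hk3, hk4⟩ := exists_block_sub hsum hi
      have hne : i ≠ n - psum γ k := fun h => hi' ⟨k, hk1, hk2, h⟩
      have h3 := h (i + 1) ⟨by omega, by omega⟩
      rw [(hact k hk1 hk2).1 (i + 1) (by omega) (by omega), Nat.add_sub_cancel] at h3
      rw [map_simpleCoroot_of_lt φ hi.1 (by omega), ← neg_eq_self_of_two_nsmul h2, ← h3, neg_sub]
    refine ⟨hI, fun k hk1 hk2 => ?_⟩
    have h1 := psum_succ γ hk1
    have h3 := hγ _ (part_mem hk1 hk2)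
    have h4 := psum_succ_le_sum γ hk2
    have h5 := hfirst ζ h2 hI k hk1 hk2
    rw [h _ ⟨by omega, by omega⟩, right_eq_add] at h5
    exact sub_eq_zero.mp h5
  · obtain ⟨hI, hk⟩ := h
    obtain ⟨k, hk1, hk2, hk3, hk4⟩ := exists_block_sub hsum hi
    rcases (show n - psum γ (k + 1) + 1 ≤ i from hk3).eq_or_lt with h4 | h4
    · rw [← h4, hfirst ζ h2 hI k hk1 hk2, hk k hk1 hk2, sub_self, zero_add]
    · have hi1 := hi.1
      obtain ⟨j, rfl⟩ : ∃ j, i = j + 1 := ⟨i - 1, by omega⟩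
      have h5 := hI j ⟨by omega, by omega⟩ (notMem_IGamma (k := k) (by omega) (by omega))
      rw [map_simpleCoroot_of_lt φ (by omega) (by omega)] at h5
      rw [(hact k hk1 hk2).1 (j + 1) h4 hk4, Nat.add_sub_cancel, ← neg_sub, h5,
        neg_eq_self_of_two_nsmul h2]

end Test

/-! ### Recognizing bases -/

lemma stdVec_mem_span_simpleCoroot {n : ℕ} (hn : 1 ≤ n) {i : ℕ} (hi : i ∈ Set.Icc 1 n) :
    stdVec n i ∈ Submodule.span ℝ (simpleCoroot n '' Set.Icc 1 n) := by
  obtain ⟨h1, h2⟩ := hi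
  have hmem : ∀ j ∈ Set.Icc 1 n,
      simpleCoroot n j ∈ Submodule.span ℝ (simpleCoroot n '' Set.Icc 1 n) :=
    fun j hj => Submodule.subset_span (Set.mem_image_of_mem _ hj)
  induction h2 using Nat.decreasingInduction with
  | self =>
    have := Submodule.smul_mem _ (1 / 2 : ℝ) (hmem n ⟨hn, le_rfl⟩)
    rwa [simpleCoroot_self hn, ← ofNat_smul_eq_nsmul ℝ, smul_smul, one_div,
      inv_mul_cancel₀ (by norm_num), one_smul] at this
  | of_succ k hk ih =>
    have := Submodule.add_mem _ (hmem k ⟨h1, hk.le⟩) (ih (by omega))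
    rwa [simpleCoroot_of_lt h1 hk, sub_add_cancel] at this

lemma span_simpleCoroot {n : ℕ} (hn : 1 ≤ n) :
    Submodule.span ℝ (simpleCoroot n '' Set.Icc 1 n) = ⊤ := by
  rw [eq_top_iff, ← (EuclideanSpace.basisFun (Fin n) ℝ).toBasis.span_eq, Submodule.span_le]
  rintro _ ⟨k, rfl⟩
  have := stdVec_mem_span_simpleCoroot hn (i := k + 1) ⟨by omega, by omega⟩
  rw [stdVec_eq_single (by simp) (by omega)] at this
  simpa using this

lemma linearIndepOn_simpleCoroot {n : ℕ} (hn : 1 ≤ n) :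
    LinearIndepOn ℝ (simpleCoroot n) (Set.Icc 1 n) := by
  refine linearIndependent_of_top_le_span_of_card_eq_finrank ?_ (by simp)
  rw [show Set.range (fun i : Set.Icc 1 n => simpleCoroot n i) = simpleCoroot n '' Set.Icc 1 n from
    Set.image_eq_range _ _ |>.symm, span_simpleCoroot hn]

/-- A family of vectors indexed by `I ⊆ [n]` is linearly independent as soon as its real span
contains the simple coroots `α_i^∨`, `i ∈ I`, for reasons of dimension. -/
lemma linearIndepOn_id_of_simpleCoroot_mem {n : ℕ} (hn : 1 ≤ n) {S : Set (V n)} {I : Set ℕ}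
    (hI : I ⊆ Set.Icc 1 n) (f : ℕ → V n) (hS : S ⊆ f '' I)
    (h : ∀ i ∈ I, simpleCoroot n i ∈ Submodule.span ℝ S) : LinearIndepOn ℤ id S := by
  have hIfin : I.Finite := (Set.finite_Icc 1 n).subset hI
  have hSfin : S.Finite := (hIfin.image f).subset hS
  have := hIfin.fintype
  have := hSfin.fintype
  have h1 : Fintype.card I ≤ Module.finrank ℝ (Submodule.span ℝ S) := by
    have hind : LinearIndependent ℝ (fun i : I => simpleCoroot n i) :=
      (linearIndepOn_simpleCoroot hn).mono hI
    have hb := finrank_span_eq_card hind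
    rw [← hb]
    refine Submodule.finrank_mono (Submodule.span_le.mpr ?_)
    rintro _ ⟨i, rfl⟩
    exact h i i.2
  have h2 : Fintype.card S ≤ Fintype.card I := by
    rw [← Nat.card_eq_fintype_card, ← Nat.card_eq_fintype_card]
    exact (Set.ncard_le_ncard hS (hIfin.image f)).trans (Set.ncard_image_le hIfin)
  have h3 : LinearIndependent ℝ (fun v : S => (v : V n)) := by
    rw [linearIndependent_iff_card_le_finrank_span, Set.finrank, Subtype.range_coe]
    exact h2.trans h1
  exact h3.restrict_scalars' ℤ

/-- The criterion used in all cases: equality of lattices is tested on additive maps out of `V n`,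
and linear independence follows by counting. -/
lemma isZBasis_of_forall_map {n : ℕ} (hn : 1 ≤ n) {w : weylGroup n} {S : Set (V n)} {I : Set ℕ}
    (hI : I ⊆ Set.Icc 1 n) (f : ℕ → V n) (hS : S ⊆ f '' I)
    (hker : ∀ (Q : Type) [AddCommGroup Q] (φ : V n →ₗ[ℤ] Q),
      (∀ v ∈ S, φ v = 0) ↔ modSet w ≤ LinearMap.ker φ)
    (hfull : ∀ (Q : Type) [AddCommGroup Q] [Module ℝ Q] (φ : V n →ₗ[ℝ] Q),
      modSet w ≤ LinearMap.ker (φ.restrictScalars ℤ) → ∀ i ∈ I, φ (simpleCoroot n i) = 0) :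
    IsZBasis S (modSet w) := by
  refine ⟨linearIndepOn_id_of_simpleCoroot_mem hn hI f hS fun i hi => ?_, le_antisymm ?_ ?_⟩
  · rw [← Submodule.Quotient.mk_eq_zero, ← Submodule.mkQ_apply]
    refine hfull _ (Submodule.span ℝ S).mkQ ((hker _ _).mp fun v hv => ?_) i hi
    simpa using Submodule.subset_span hv
  · rw [Submodule.span_le]
    intro v hv
    have := (hker _ (modSet w).mkQ).mpr (by rw [Submodule.ker_mkQ]) v hv
    simpa using this
  · have := (hker _ (Submodule.span ℤ S).mkQ).mp fun v hv => by
      simpa using Submodule.subset_span hv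
    rwa [Submodule.ker_mkQ] at this

/-! ### Chains of congruences -/

/-- If neighbouring terms outside `I` agree, also across isolated elements of `I`, then all terms
outside `I` up to `m` agree with the `m`-th one. -/
lemma eq_of_chain {Q : Type*} {A : ℕ → Q} {I : Set ℕ} {m : ℕ} (hm : m ∉ I)
    (hgap : ∀ i, i + 2 ≤ m → i + 1 ∈ I → i + 2 ∉ I)
    (h1 : ∀ i, 1 ≤ i → i < m → i ∉ I → i + 1 ∉ I → A i = A (i + 1))
    (h2 : ∀ i, 1 ≤ i → i + 2 ≤ m → i ∉ I → i + 1 ∈ I → A i = A (i + 2)) {i : ℕ} (hi : 1 ≤ i)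
    (him : i ≤ m) (hiI : i ∉ I) : A i = A m := by
  induction hd : m - i using Nat.strong_induction_on generalizing i with
  | _ d ih =>
    rcases him.eq_or_lt with rfl | hlt
    · rfl
    · by_cases h : i + 1 ∈ I
      · have h3 : i + 1 ≠ m := fun h' => hm (h' ▸ h)
        rw [h2 i hi (by omega) hiI h]
        exact ih (m - (i + 2)) (by omega) (by omega) (by omega) (hgap i (by omega) h) rfl
      · rw [h1 i hi hlt hiI h]
        exact ih (m - (i + 1)) (by omega) (by omega) hlt h rfl

/-! ### The case of negative blocks -/

lemma mem_shift_iff {I : Set ℕ} (hI : ∀ i ∈ I, 1 ≤ i) {i : ℕ} : i ∈ shift I ↔ i + 1 ∈ I := by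
  constructor
  · rintro ⟨j, hj, rfl⟩
    have := hI j hj
    simpa only [Nat.sub_add_cancel this] using hj
  · exact fun h => ⟨i + 1, h, rfl⟩

lemma wRep_nil_left (n : ℕ) (γ : List ℕ) : wRep n [] γ = wGamma n γ := one_mul _

lemma wRep_nil_right (n : ℕ) (β : List ℕ) : wRep n β [] = wBeta n β := mul_one _

lemma le_length_of_one_le_part {l : List ℕ} {k : ℕ} (hk : 1 ≤ k) (h : 1 ≤ part l k) :
    k ≤ l.length := by
  by_contra h'
  rw [part, List.getD_eq_default _ _ (by omega)] at h
  omega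

section Gamma

variable {n : ℕ} {γ : List ℕ}

lemma IsIncPartition.part_le (hγ : IsIncPartition γ) {j k : ℕ} (hj : 1 ≤ j) (hjk : j ≤ k)
    (hk : k ≤ γ.length) : part γ j ≤ part γ k := by
  rw [part, part, List.getD_eq_getElem _ _ (by omega), List.getD_eq_getElem _ _ (by omega)]
  rcases hjk.eq_or_lt with rfl | h
  · rfl
  · exact List.pairwise_iff_getElem.mp hγ.1 _ _ _ _ (by omega)

lemma IGamma_subset (hγ : ∀ a ∈ γ, 1 ≤ a) (hsum : γ.sum = n) : IGamma n γ ⊆ Set.Icc 1 n := by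
  rintro _ ⟨k, h1, h2, rfl⟩
  have := psum_succ γ h1
  have := hγ _ (part_mem h1 h2)
  have := psum_succ_le_sum γ h2
  exact ⟨by omega, by omega⟩

/-- Two neighbouring elements of `I_γ ∪ {0}` enclose a part equal to `1`. -/
lemma exists_part_eq_one (hγ : ∀ a ∈ γ, 1 ≤ a) (hsum : γ.sum = n) {j : ℕ}
    (hj : j = 0 ∨ j ∈ IGamma n γ) (hj' : j + 1 ∈ IGamma n γ) :
    ∃ k, 1 ≤ k ∧ k ≤ γ.length ∧ part γ k = 1 ∧ j + 1 = n - psum γ k := by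
  obtain ⟨k, h1, h2, h3⟩ := hj'
  have h4 := psum_succ γ h1
  have h5 := hγ _ (part_mem h1 h2)
  have h6 := psum_succ_le_sum γ h2
  refine ⟨k, h1, h2, ?_, h3⟩
  rcases hj with rfl | ⟨k', h1', h2', h3'⟩
  · omega
  · rcases Nat.lt_or_ge k k' with h | h
    · have := psum_mono γ (show k + 1 ≤ k' from h)
      have := psum_succ γ h1'
      have := hγ _ (part_mem h1' h2')
      have := psum_succ_le_sum γ h2'
      omega
    · have := psum_mono γ h
      omega

/-- The elements of `I_γ` are numbered by the blocks. -/
lemma exists_block_index (hγ : ∀ a ∈ γ, 1 ≤ a) (hsum : γ.sum = n) :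
    ∃ κ : ℕ → ℕ, ∀ k, 1 ≤ k → k ≤ γ.length → κ (n - psum γ k) = k := by
  have hlt : ∀ j k, 1 ≤ j → j < k → k ≤ γ.length → n - psum γ k < n - psum γ j := by
    intro j k hj hjk hk
    have := psum_succ γ hj
    have := hγ _ (part_mem hj (by omega))
    have := psum_mono γ (show j + 1 ≤ k from hjk)
    have := psum_mono γ (show k ≤ k + 1 by omega)
    have := psum_succ_le_sum γ hk
    omega
  have hinj : Set.InjOn (fun k => n - psum γ k) (Set.Icc 1 γ.length) := by
    intro j hj k hk hjk
    rcases lt_trichotomy j k with h | h | h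
    · exact absurd hjk (hlt j k hj.1 h hk.2).ne'
    · exact h
    · exact absurd hjk (hlt k j hk.1 h hj.2).ne
  exact ⟨_, fun k h1 h2 => hinj.leftInvOn_invFunOn ⟨h1, h2⟩⟩

variable {Q : Type*} [AddCommGroup Q]

lemma two_nsmul_map_simpleCoroot (hγ : ∀ a ∈ γ, 1 ≤ a) (hsum : γ.sum = n) (φ : V n →ₗ[ℤ] Q)
    {ζ : Q} (h2 : 2 • ζ = 0)
    (hI : ∀ i ∈ Set.Icc 1 n, i ∉ IGamma n γ → φ (simpleCoroot n i) = ζ) {k : ℕ} (hk : 1 ≤ k)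
    (hk' : k + 1 ≤ γ.length) :
    2 • φ (simpleCoroot n (n - psum γ (k + 1))) =
      2 • φ (stdVec n (n - psum γ (k + 1))) - 2 • φ (stdVec n (n - psum γ k)) := by
  have h3 := psum_succ γ hk
  have h4 := hγ _ (part_mem hk (by omega))
  have h5 := psum_succ γ (show 1 ≤ k + 1 by omega)
  have h6 := hγ _ (part_mem (show 1 ≤ k + 1 by omega) hk')
  have h7 := psum_succ_le_sum γ hk'
  have h8 := map_stdVec_eq φ (ζ := ζ) (a := n - psum γ (k + 1) + 1) (b := n - psum γ k)
    (by omega) (by omega) (by omega) fun i hi hi' =>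
      hI i ⟨by omega, by omega⟩ (notMem_IGamma (by omega) hi')
  rw [map_simpleCoroot_of_lt φ (by omega) (by omega), h8, nsmul_sub, nsmul_add,
    smul_comm 2 _ ζ, h2, smul_zero, add_zero]

/-- The vectors `2 α_b^∨ + γ_{k,k-1} ζ` transport the condition on `2 e_b` from block to block. -/
lemma forall_jump_iff (hγ : ∀ a ∈ γ, 1 ≤ a) (hsum : γ.sum = n) (φ : V n →ₗ[ℤ] Q)
    {ζ : Q} (h2 : 2 • ζ = 0)
    (hI : ∀ i ∈ Set.Icc 1 n, i ∉ IGamma n γ → φ (simpleCoroot n i) = ζ)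
    (h1 : 2 • φ (stdVec n n) = part γ 1 • ζ) :
    (∀ k, 2 ≤ k → k ≤ γ.length →
      2 • φ (simpleCoroot n (n - psum γ k)) + jump γ k • ζ = 0) ↔
    ∀ k, 1 ≤ k → k ≤ γ.length → 2 • φ (stdVec n (n - psum γ k)) = part γ k • ζ := by
  have hjump : ∀ k, 1 ≤ k → jump γ (k + 1) • ζ = part γ (k + 1) • ζ + part γ k • ζ := by
    intro k hk
    rw [← add_nsmul, jump, if_neg (by omega), Nat.add_sub_cancel]
    exact nsmul_congr_mod_two h2 (Nat.mod_mod _ _)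
  have h2' : ∀ k : ℕ, k • ζ + k • ζ = 0 := fun k => by
    rw [← two_nsmul, smul_comm, h2, smul_zero]
  constructor
  · intro h k hk
    induction k, hk using Nat.le_induction with
    | base => exact fun _ => h1
    | succ k hk ih =>
      intro hk'
      have h3 := h (k + 1) (by omega) hk'
      rw [two_nsmul_map_simpleCoroot hγ hsum φ h2 hI hk hk', ih (by omega), hjump k hk,
        sub_add_add_cancel] at h3
      rw [← add_left_inj (part γ (k + 1) • ζ), h3, h2']
  · intro h k hk hk'
    obtain ⟨k, rfl⟩ : ∃ j, k = j + 1 := ⟨k - 1, by omega⟩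
    rw [two_nsmul_map_simpleCoroot hγ hsum φ h2 hI (by omega) hk', h _ (by omega) hk',
      h k (by omega) (by omega), hjump k (by omega), sub_add_add_cancel, h2']

/-- A map to a real vector space which kills `Mod(w_γ)` is zero: `Mod(w_γ)` has full rank. -/
lemma map_eq_zero_of_modSet_wGamma_le (hn : 1 ≤ n) (hγ : ∀ a ∈ γ, 1 ≤ a) (hsum : γ.sum = n)
    [Module ℝ Q] (φ : V n →ₗ[ℝ] Q)
    (h : modSet (wGamma n γ) ≤ LinearMap.ker (φ.restrictScalars ℤ)) {i : ℕ}
    (hi : i ∈ Set.Icc 1 n) : φ (simpleCoroot n i) = 0 := by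
  obtain ⟨ζ, h2, hI, hk⟩ := (modSet_wGamma_le_ker_iff hn hγ hsum _).mp h
  have two : ∀ x : Q, 2 • x = 0 → x = 0 := fun x hx => by
    rw [← ofNat_smul_eq_nsmul ℝ] at hx
    exact (smul_eq_zero.mp hx).resolve_left two_ne_zero
  obtain rfl := two ζ h2
  by_cases hiI : i ∈ IGamma n γ
  · obtain ⟨k, hk1, hk2, rfl⟩ := hiI
    refine two _ ?_
    rcases hk1.eq_or_lt with rfl | hk1
    · have h3 := hk 1 le_rfl hk2
      rw [psum_one, Nat.sub_zero, smul_zero] at h3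
      have h4 := map_simpleCoroot_self (φ.restrictScalars ℤ) hn
      rw [h3] at h4
      rw [psum_one, Nat.sub_zero]
      exact (congrArg (2 • ·) h4).trans (smul_zero _)
    · obtain ⟨k, rfl⟩ : ∃ j, k = j + 1 := ⟨k - 1, by omega⟩
      refine (two_nsmul_map_simpleCoroot hγ hsum (φ.restrictScalars ℤ) h2 hI
        (by omega) hk2).trans ?_
      rw [hk _ (by omega) hk2, hk k (by omega) (by omega), smul_zero, smul_zero, sub_zero]
  · exact hI i hi hiI

end Gamma

open Classical in
/-- The basis of `Mod(w_γ)` if all parts of `γ` are at least `2`. The index `ε` is chosen such that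
a map killing `Mod(w_γ)` takes the value `ζ` on `α_ε^∨`: its value on `α_n^∨` is `γ_1 ζ`. -/
theorem isZBasis_wGamma_of_two_le {n : ℕ} (hn : 2 ≤ n) {γ : List ℕ} (hγ : IsIncPartition γ)
    (hsum : γ.sum = n) (h1 : 2 ≤ part γ 1) {ε : ℕ}
    (hε : ε = if Odd (part γ 1) then n else n - 1) :
    IsZBasis
      ({v | ∃ k, 2 ≤ k ∧ k ≤ γ.length ∧
          v = 2 • simpleCoroot n (n - psum γ k) + jump γ k • simpleCoroot n ε} ∪
        {2 • simpleCoroot n (n - 1),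
          (part γ 1 % 2) • simpleCoroot n (n - 1) + simpleCoroot n n} ∪
        {v | ∃ i ∈ Set.Icc 1 n, i ∉ IGamma n γ ∪ shift (IGamma n γ) ∧
          v = -simpleCoroot n i + simpleCoroot n (i + 1)} ∪
        {v | ∃ i ∈ shift (IGamma n γ), i ≠ n - 1 ∧
          v = -simpleCoroot n i + simpleCoroot n (i + 2)})
      (modSet (wGamma n γ)) := by
  have hsub := IGamma_subset hγ.2 hsum
  have hsh : ∀ {i}, i ∈ shift (IGamma n γ) ↔ i + 1 ∈ IGamma n γ :=
    mem_shift_iff fun i hi => (hsub hi).1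
  have hlen : 1 ≤ γ.length := le_length_of_one_le_part le_rfl (by omega)
  have hgap : ∀ i, (i = 0 ∨ i ∈ IGamma n γ) → i + 1 ∉ IGamma n γ := by
    intro i hi hi'
    obtain ⟨k, hk1, hk2, hk3, -⟩ := exists_part_eq_one hγ.2 hsum hi hi'
    have := hγ.part_le le_rfl hk1 hk2
    omega
  have hnI : n ∈ IGamma n γ := ⟨1, le_rfl, hlen, by rw [psum_one, Nat.sub_zero]⟩
  have hnI' : n - 1 ∉ IGamma n γ := fun h => hgap (n - 1) (Or.inr h) (by
    rwa [Nat.sub_add_cancel (by omega)])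
  have hb : ∀ k, 2 ≤ k → k ≤ γ.length →
      1 ≤ n - psum γ k ∧ n - psum γ k ≤ n - 2 ∧ n - psum γ k ∈ IGamma n γ := by
    intro k hk hk'
    have h3 : n - psum γ k ∈ IGamma n γ := ⟨k, by omega, hk', rfl⟩
    have h4 := psum_mono γ hk
    rw [psum_succ γ le_rfl, psum_one] at h4
    exact ⟨(hsub h3).1, by omega, h3⟩
  have hi2 : ∀ i, i + 1 ∈ IGamma n γ → i ≠ n - 1 →
      1 ≤ i ∧ i + 2 ≤ n ∧ i ∉ IGamma n γ ∧ i + 2 ∉ IGamma n γ := by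
    intro i hi hi'
    have h3 := (hsub hi).2
    exact ⟨Nat.one_le_iff_ne_zero.mpr fun h => hgap i (Or.inl h) hi, by omega,
      fun h => hgap i (Or.inr h) hi, hgap (i + 1) (Or.inr hi)⟩
  obtain ⟨κ, hκ⟩ := exists_block_index hγ.2 hsum
  refine isZBasis_of_forall_map (by omega) (I := Set.Icc 1 n) subset_rfl
    (fun i => if i = n then (part γ 1 % 2) • simpleCoroot n (n - 1) + simpleCoroot n n
      else if i = n - 1 then 2 • simpleCoroot n (n - 1)
      else if i ∈ IGamma n γ then 2 • simpleCoroot n i + jump γ (κ i) • simpleCoroot n ε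
      else if i + 1 ∈ IGamma n γ then -simpleCoroot n i + simpleCoroot n (i + 2)
      else -simpleCoroot n i + simpleCoroot n (i + 1)) ?_ (fun Q _ φ => ?_)
    fun Q _ _ φ h i hi => map_eq_zero_of_modSet_wGamma_le (by omega) hγ.2 hsum φ h hi
  · rintro v (((⟨k, hk, hk', rfl⟩ | rfl | rfl) | ⟨i, hi, hiI, rfl⟩) | ⟨i, hi, hi', rfl⟩)
    · obtain ⟨h3, h4, h5⟩ := hb k hk hk'
      refine ⟨n - psum γ k, ⟨h3, by omega⟩, ?_⟩
      simp only [if_neg (show n - psum γ k ≠ n by omega),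
        if_neg (show n - psum γ k ≠ n - 1 by omega), if_pos h5, hκ k (by omega) hk']
    · refine ⟨n - 1, ⟨by omega, by omega⟩, ?_⟩
      simp only [if_neg (show n - 1 ≠ n by omega), if_true]
    · exact ⟨n, ⟨by omega, le_rfl⟩, by simp only [if_true]⟩
    · rw [Set.mem_union, hsh, not_or] at hiI
      refine ⟨i, hi, ?_⟩
      have h3 : i ≠ n := fun h => hiI.1 (h ▸ hnI)
      have h4 : i ≠ n - 1 := fun h => hiI.2 (by rwa [h, Nat.sub_add_cancel (by omega)])
      simp only [if_neg h3, if_neg h4, if_neg hiI.1, if_neg hiI.2]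
    · rw [hsh] at hi
      obtain ⟨h3, h4, h5, -⟩ := hi2 i hi hi'
      refine ⟨i, ⟨h3, by omega⟩, ?_⟩
      simp only [if_neg (show i ≠ n by omega), if_neg hi', if_neg h5, if_pos hi]
  · rw [modSet_wGamma_le_ker_iff (by omega) hγ.2 hsum]
    constructor
    · intro h
      have h2 : 2 • φ (simpleCoroot n (n - 1)) = 0 := by
        rw [← map_nsmul]; exact h _ (by simp)
      have hself : (part γ 1 % 2) • φ (simpleCoroot n (n - 1)) + φ (simpleCoroot n n) = 0 := by
        rw [← map_nsmul, ← map_add]; exact h _ (by simp)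
      have hn1 : φ (simpleCoroot n n) = part γ 1 • φ (simpleCoroot n (n - 1)) := by
        rw [← neg_eq_of_add_eq_zero_right hself, ← smul_neg, neg_eq_self_of_two_nsmul h2]
        exact nsmul_congr_mod_two h2 (Nat.mod_mod _ _)
      have hε' : φ (simpleCoroot n ε) = φ (simpleCoroot n (n - 1)) := by
        rw [hε]
        split_ifs with hodd
        · rw [hn1]
          exact (nsmul_congr_mod_two h2 (Nat.odd_iff.mp hodd)).trans (one_nsmul _)
        · rfl
      have hI : ∀ i ∈ Set.Icc 1 n, i ∉ IGamma n γ →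
          φ (simpleCoroot n i) = φ (simpleCoroot n (n - 1)) := by
        intro i hi hiI
        have h3 : i ≠ n := fun h => hiI (h ▸ hnI)
        have h4 := hi.2
        refine eq_of_chain (A := fun i => φ (simpleCoroot n i)) hnI'
          (fun i hi hi' => hgap (i + 1) (Or.inr hi')) (fun i hi1 hi2 hi3 hi4 => ?_)
          (fun i hi1 hi2 hi3 hi4 => ?_) hi.1 (by omega) hiI
        · have := h (-simpleCoroot n i + simpleCoroot n (i + 1)) (Or.inl (Or.inr
            ⟨i, ⟨hi1, by omega⟩, by rw [Set.mem_union, hsh, not_or]; exact ⟨hi3, hi4⟩, rfl⟩))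
          rw [map_add, map_neg] at this
          exact neg_add_eq_zero.mp this
        · have := h (-simpleCoroot n i + simpleCoroot n (i + 2)) (Or.inr
            ⟨i, hsh.mpr hi4, by omega, rfl⟩)
          rw [map_add, map_neg] at this
          exact neg_add_eq_zero.mp this
      refine ⟨_, h2, hI, (forall_jump_iff hγ.2 hsum φ h2 hI ?_).mp fun k hk hk' => ?_⟩
      · rw [← map_simpleCoroot_self φ (by omega), hn1]
      · rw [← hε', ← map_nsmul, ← map_nsmul, ← map_add]
        exact h _ (Or.inl (Or.inl (Or.inl ⟨k, hk, hk', rfl⟩)))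
    · rintro ⟨ζ, h2, hI, hk⟩
      have hn1 : 2 • φ (stdVec n n) = part γ 1 • ζ := by
        have := hk 1 le_rfl hlen
        rwa [psum_one, Nat.sub_zero] at this
      have hself : φ (simpleCoroot n n) = part γ 1 • ζ := by
        rw [map_simpleCoroot_self φ (by omega), hn1]
      have hpred : φ (simpleCoroot n (n - 1)) = ζ := hI _ ⟨by omega, by omega⟩ hnI'
      have hε' : φ (simpleCoroot n ε) = ζ := by
        rw [hε]
        split_ifs with hodd
        · rw [hself]
          exact (nsmul_congr_mod_two h2 (Nat.odd_iff.mp hodd)).trans (one_nsmul _)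
        · exact hpred
      have hj := (forall_jump_iff hγ.2 hsum φ h2 hI hn1).mpr hk
      rintro v (((⟨k, hk, hk', rfl⟩ | rfl | rfl) | ⟨i, hi, hiI, rfl⟩) | ⟨i, hi, hi', rfl⟩)
      · rw [map_add, map_nsmul, map_nsmul, hε', hj k hk hk']
      · rw [map_nsmul, hpred, h2]
      · rw [map_add, map_nsmul, hpred, hself, ← add_nsmul, ← zero_nsmul ζ]
        exact nsmul_congr_mod_two h2 (by omega)
      · rw [Set.mem_union, hsh, not_or] at hiI
        have h3 : i ≠ n := fun h => hiI.1 (h ▸ hnI)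
        have h4 := hi.2
        rw [map_add, map_neg, hI i hi hiI.1, hI (i + 1) ⟨by omega, by omega⟩ hiI.2,
          neg_add_cancel]
      · rw [hsh] at hi
        obtain ⟨h3, h4, h5, h6⟩ := hi2 i hi hi'
        rw [map_add, map_neg, hI i ⟨h3, by omega⟩ h5, hI (i + 2) ⟨by omega, h4⟩ h6,
          neg_add_cancel]

lemma psum_eq_of_part_eq_one {l : List ℕ} {r : ℕ} (h : ∀ k, 1 ≤ k → k ≤ r → part l k = 1) {k : ℕ}
    (hk : 1 ≤ k) (hk' : k ≤ r + 1) : psum l k = k - 1 := by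
  induction k, hk using Nat.le_induction with
  | base => exact psum_one l
  | succ k hk ih =>
    have := h k hk (by omega)
    rw [psum_succ l hk, ih (by omega), this]
    omega

open Classical in
/-- The basis of `Mod(w_γ)` if `γ` starts with `ℓ ≥ 1` parts equal to `1`, followed by larger
ones. -/
theorem isZBasis_wGamma_of_ones {n : ℕ} {γ : List ℕ} (hγ : IsIncPartition γ)
    (hsum : γ.sum = n) {l : ℕ} (hl : 1 ≤ l) (h1 : ∀ k, 1 ≤ k → k ≤ l → part γ k = 1)
    (h2 : 2 ≤ part γ (l + 1)) :
    IsZBasis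
      ({v | ∃ k, 1 ≤ k ∧ k ≤ γ.length ∧
          v = 2 • simpleCoroot n (n - psum γ k) + jump γ k • simpleCoroot n n} ∪
        {-simpleCoroot n (n - l - 1) + simpleCoroot n n} ∪
        {v | ∃ i ∈ Set.Icc 1 n, i ∉ IGamma n γ ∪ shift (IGamma n γ) ∧
          v = -simpleCoroot n i + simpleCoroot n (i + 1)} ∪
        {v | ∃ i ∈ shift (IGamma n γ), i < n - l - 1 ∧
          v = -simpleCoroot n i + simpleCoroot n (i + 2)})
      (modSet (wGamma n γ)) := by
  have hsub := IGamma_subset hγ.2 hsum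
  have hsh : ∀ {i}, i ∈ shift (IGamma n γ) ↔ i + 1 ∈ IGamma n γ :=
    mem_shift_iff fun i hi => (hsub hi).1
  have hlen : l + 1 ≤ γ.length := le_length_of_one_le_part (by omega) (by omega)
  have hpl := psum_eq_of_part_eq_one h1 (k := l + 1) (by omega) le_rfl
  have hpl' := psum_succ γ (k := l + 1) (by omega)
  have hle := psum_succ_le_sum γ hlen
  have hn : l + 2 ≤ n := by omega
  have hgap : ∀ i, i ≤ n - l - 1 → (i = 0 ∨ i ∈ IGamma n γ) → i + 1 ∉ IGamma n γ := by
    intro i hil hi hi'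
    obtain ⟨k, hk1, hk2, hk3, hk4⟩ := exists_part_eq_one hγ.2 hsum hi hi'
    have hkl : k ≤ l := by
      by_contra h
      have := hγ.part_le (show 1 ≤ l + 1 by omega) (show l + 1 ≤ k by omega) hk2
      omega
    rw [psum_eq_of_part_eq_one h1 hk1 (by omega)] at hk4
    omega
  have htop : ∀ i, n - l ≤ i → i ≤ n → i ∈ IGamma n γ := fun i hi hi' =>
    ⟨n - i + 1, by omega, by omega, by
      rw [psum_eq_of_part_eq_one h1 (by omega) (by omega)]; omega⟩
  have hm : n - l - 1 ∉ IGamma n γ := notMem_IGamma (k := l + 1) (by omega) (by omega)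
  have hm' : n - l - 1 + 1 ∈ IGamma n γ := htop _ (by omega) (by omega)
  have hi2 : ∀ i, i + 1 ∈ IGamma n γ → i < n - l - 1 →
      1 ≤ i ∧ i ∉ IGamma n γ ∧ i + 2 ∉ IGamma n γ := by
    intro i hi hi'
    exact ⟨Nat.one_le_iff_ne_zero.mpr fun h => hgap i hi'.le (Or.inl h) hi,
      fun h => hgap i hi'.le (Or.inr h) hi, hgap (i + 1) hi' (Or.inr hi)⟩
  obtain ⟨κ, hκ⟩ := exists_block_index hγ.2 hsum
  refine isZBasis_of_forall_map (by omega) (I := Set.Icc 1 n) subset_rfl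
    (fun i => if i ∈ IGamma n γ then 2 • simpleCoroot n i + jump γ (κ i) • simpleCoroot n n
      else if i = n - l - 1 then -simpleCoroot n (n - l - 1) + simpleCoroot n n
      else if i + 1 ∈ IGamma n γ then -simpleCoroot n i + simpleCoroot n (i + 2)
      else -simpleCoroot n i + simpleCoroot n (i + 1)) ?_ (fun Q _ φ => ?_)
    fun Q _ _ φ h i hi => map_eq_zero_of_modSet_wGamma_le (by omega) hγ.2 hsum φ h hi
  · rintro v (((⟨k, hk, hk', rfl⟩ | rfl) | ⟨i, hi, hiI, rfl⟩) | ⟨i, hi, hi', rfl⟩)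
    · have h3 : n - psum γ k ∈ IGamma n γ := ⟨k, hk, hk', rfl⟩
      exact ⟨n - psum γ k, hsub h3, by simp only [if_pos h3, hκ k hk hk']⟩
    · exact ⟨n - l - 1, ⟨by omega, by omega⟩, by simp only [if_neg hm, if_true]⟩
    · rw [Set.mem_union, hsh, not_or] at hiI
      have h4 : i ≠ n - l - 1 := fun h => hiI.2 (h ▸ hm')
      exact ⟨i, hi, by simp only [if_neg h4, if_neg hiI.1, if_neg hiI.2]⟩
    · rw [hsh] at hi
      obtain ⟨h3, h4, -⟩ := hi2 i hi hi'
      exact ⟨i, ⟨h3, by omega⟩, by simp only [if_neg hi'.ne, if_neg h4, if_pos hi]⟩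
  · rw [modSet_wGamma_le_ker_iff (by omega) hγ.2 hsum]
    constructor
    · intro h
      have hk : ∀ k, 1 ≤ k → k ≤ γ.length →
          2 • φ (simpleCoroot n (n - psum γ k)) + jump γ k • φ (simpleCoroot n n) = 0 := by
        intro k hk hk'
        rw [← map_nsmul, ← map_nsmul, ← map_add]
        exact h _ (Or.inl (Or.inl (Or.inl ⟨k, hk, hk', rfl⟩)))
      have h2 : 2 • φ (simpleCoroot n n) = 0 := by
        have := hk 1 le_rfl (by omega)
        rwa [psum_one, Nat.sub_zero, jump, if_pos le_rfl, zero_nsmul, add_zero] at this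
      have hm1 : φ (simpleCoroot n (n - l - 1)) = φ (simpleCoroot n n) := by
        have := h (-simpleCoroot n (n - l - 1) + simpleCoroot n n)
          (Or.inl (Or.inl (Or.inr rfl)))
        rw [map_add, map_neg] at this
        exact neg_add_eq_zero.mp this
      have hI : ∀ i ∈ Set.Icc 1 n, i ∉ IGamma n γ →
          φ (simpleCoroot n i) = φ (simpleCoroot n n) := by
        intro i hi hiI
        have h3 : i < n - l := by
          by_contra h
          exact hiI (htop i (by omega) hi.2)
        rw [← hm1]
        refine eq_of_chain (A := fun i => φ (simpleCoroot n i)) hm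
          (fun i hi hi' => hgap (i + 1) (by omega) (Or.inr hi')) (fun i hi1 hi2 hi3 hi4 => ?_)
          (fun i hi1 hi2 hi3 hi4 => ?_) hi.1 (by omega) hiI
        · have := h (-simpleCoroot n i + simpleCoroot n (i + 1)) (Or.inl (Or.inr
            ⟨i, ⟨hi1, by omega⟩, by rw [Set.mem_union, hsh, not_or]; exact ⟨hi3, hi4⟩, rfl⟩))
          rw [map_add, map_neg] at this
          exact neg_add_eq_zero.mp this
        · have := h (-simpleCoroot n i + simpleCoroot n (i + 2)) (Or.inr
            ⟨i, hsh.mpr hi4, by omega, rfl⟩)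
          rw [map_add, map_neg] at this
          exact neg_add_eq_zero.mp this
      refine ⟨_, h2, hI, (forall_jump_iff hγ.2 hsum φ h2 hI ?_).mp fun k hk1 hk' =>
        hk k (by omega) hk'⟩
      rw [h1 1 le_rfl hl, one_nsmul, map_simpleCoroot_self φ (by omega)]
    · rintro ⟨ζ, h2, hI, hk⟩
      have hn1 : 2 • φ (stdVec n n) = part γ 1 • ζ := by
        have := hk 1 le_rfl (by omega)
        rwa [psum_one, Nat.sub_zero] at this
      have hself : φ (simpleCoroot n n) = ζ := by
        rw [map_simpleCoroot_self φ (by omega), hn1, h1 1 le_rfl hl, one_nsmul]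
      have hj := (forall_jump_iff hγ.2 hsum φ h2 hI hn1).mpr hk
      rintro v (((⟨k, hk, hk', rfl⟩ | rfl) | ⟨i, hi, hiI, rfl⟩) | ⟨i, hi, hi', rfl⟩)
      · rw [map_add, map_nsmul, map_nsmul, hself]
        rcases hk.eq_or_lt with rfl | hk
        · rw [psum_one, Nat.sub_zero, hself, h2, jump, if_pos le_rfl, zero_nsmul, add_zero]
        · exact hj k hk hk'
      · rw [map_add, map_neg, hself, hI _ ⟨by omega, by omega⟩ hm, neg_add_cancel]
      · rw [Set.mem_union, hsh, not_or] at hiI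
        have h3 : i ≠ n := fun h => hiI.1 (htop i (by omega) hi.2)
        have h4 := hi.2
        rw [map_add, map_neg, hI i hi hiI.1, hI (i + 1) ⟨by omega, by omega⟩ hiI.2,
          neg_add_cancel]
      · rw [hsh] at hi
        obtain ⟨h3, h4, h5⟩ := hi2 i hi hi'
        rw [map_add, map_neg, hI i ⟨h3, by omega⟩ h4, hI (i + 2) ⟨by omega, by omega⟩ h5,
          neg_add_cancel]

/-- The basis of `Mod(w_γ)` if all parts of `γ` are `1`, that is, if `w_γ = -1`. -/
theorem isZBasis_wGamma_replicate_one {n : ℕ} (hn : 1 ≤ n) :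
    IsZBasis {v | ∃ i ∈ Set.Icc 1 n, v = 2 • simpleCoroot n i}
      (modSet (wGamma n (List.replicate n 1))) := by
  have hγ : ∀ a ∈ List.replicate n 1, 1 ≤ a := fun a ha => (List.eq_of_mem_replicate ha).ge
  have hsum : (List.replicate n 1).sum = n := by simp
  have h1 : ∀ k, 1 ≤ k → k ≤ n → part (List.replicate n 1) k = 1 := fun k hk hk' =>
    List.eq_of_mem_replicate (part_mem hk (by simpa using hk'))
  have hp : ∀ i ∈ Set.Icc 1 n, n - psum (List.replicate n 1) (n - i + 1) = i := by
    rintro i ⟨hi, hi'⟩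
    rw [psum_eq_of_part_eq_one h1 (by omega) (by omega)]
    omega
  have hall : ∀ i ∈ Set.Icc 1 n, i ∈ IGamma n (List.replicate n 1) := fun i hi =>
    ⟨n - i + 1, by omega, by
      have := hi.1
      rw [List.length_replicate]; omega, (hp i hi).symm⟩
  have hjump : ∀ k, 2 ≤ k → k ≤ n → jump (List.replicate n 1) k = 0 := by
    intro k hk hk'
    rw [jump, if_neg (by omega), h1 k (by omega) hk', h1 (k - 1) (by omega) (by omega)]
  refine isZBasis_of_forall_map hn (I := Set.Icc 1 n) subset_rfl (fun i => 2 • simpleCoroot n i)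
    ?_ (fun Q _ φ => ?_) fun Q _ _ φ h i hi => map_eq_zero_of_modSet_wGamma_le hn hγ hsum φ h hi
  · rintro v ⟨i, hi, rfl⟩
    exact ⟨i, hi, rfl⟩
  · rw [modSet_wGamma_le_ker_iff hn hγ hsum]
    constructor
    · intro h
      have h' : ∀ i ∈ Set.Icc 1 n, 2 • φ (simpleCoroot n i) = 0 := fun i hi => by
        rw [← map_nsmul]; exact h _ ⟨i, hi, rfl⟩
      have h2 := h' n ⟨hn, le_rfl⟩
      have hI : ∀ i ∈ Set.Icc 1 n, i ∉ IGamma n (List.replicate n 1) →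
          φ (simpleCoroot n i) = φ (simpleCoroot n n) := fun i hi hi' => absurd (hall i hi) hi'
      refine ⟨_, h2, hI, (forall_jump_iff hγ hsum φ h2 hI ?_).mp fun k hk hk' => ?_⟩
      · rw [h1 1 le_rfl hn, one_nsmul, map_simpleCoroot_self φ hn]
      · rw [hjump k hk (by simpa using hk'), zero_nsmul, add_zero]
        exact h' _ (IGamma_subset hγ hsum ⟨k, by omega, hk', rfl⟩)
    · rintro ⟨ζ, h2, hI, hk⟩
      have hn1 : 2 • φ (stdVec n n) = part (List.replicate n 1) 1 • ζ := by
        have := hk 1 le_rfl (by simpa using hn)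
        rwa [psum_one, Nat.sub_zero] at this
      have hj := (forall_jump_iff hγ hsum φ h2 hI hn1).mpr hk
      rintro v ⟨i, hi, rfl⟩
      rw [map_nsmul]
      rcases hi.2.eq_or_lt with rfl | hlt
      · rw [map_simpleCoroot_self φ hn, hn1, h1 1 le_rfl hn, one_nsmul, h2]
      · have := hi.1
        have h3 := hj (n - i + 1) (by omega) (by rw [List.length_replicate]; omega)
        rwa [hjump _ (by omega) (by omega), zero_nsmul, add_zero, hp i hi] at h3

/-! ### The case of positive blocks -/

section Beta

variable {n : ℕ} {β : List ℕ}

lemma IsDecPartition.le_part (hβ : IsDecPartition β) {k : ℕ} (hk : 1 ≤ k) (hk' : k ≤ β.length) :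
    part β β.length ≤ part β k := by
  rw [part, part, List.getD_eq_getElem _ _ (by omega), List.getD_eq_getElem _ _ (by omega)]
  rcases hk'.eq_or_lt with rfl | h
  · rfl
  · exact List.pairwise_iff_getElem.mp hβ.1 _ _ _ _ (by omega)

lemma mem_IBeta_iff (hβ : 1 ≤ β.length) {i : ℕ} :
    i ∈ IBeta β ↔ ∃ k, 1 ≤ k ∧ k ≤ β.length ∧ i = psum β (k + 1) := by
  constructor
  · rintro (⟨k, h1, h2, rfl⟩ | rfl)
    · exact ⟨k - 1, by omega, by omega, by rw [Nat.sub_add_cancel (by omega)]⟩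
    · exact ⟨β.length, hβ, le_rfl, (psum_length_succ β).symm⟩
  · rintro ⟨k, h1, h2, rfl⟩
    rcases h2.eq_or_lt with rfl | h2
    · exact Or.inr (psum_length_succ β)
    · exact Or.inl ⟨k + 1, by omega, h2, rfl⟩

lemma mem_J_iff_notMem_IBeta (hβ : ∀ a ∈ β, 1 ≤ a) (hsum : β.sum = n) {i : ℕ}
    (hi : i ∈ Set.Icc 1 n) : i ∈ J β ↔ i ∉ IBeta β := by
  obtain ⟨hi1, hi2⟩ := hi
  have hlen : 1 ≤ β.length := by
    rcases β with _ | ⟨a, l⟩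
    · rw [List.sum_nil] at hsum; omega
    · simp
  rw [mem_J_iff hβ, mem_IBeta_iff hlen]
  constructor
  · rintro ⟨k, h1, h2, h3, h4⟩ ⟨j, h5, h6, rfl⟩
    rcases Nat.lt_or_ge j k with h | h
    · have := psum_mono β (show j + 1 ≤ k from h); omega
    · have := psum_mono β (show k + 1 ≤ j + 1 by omega); omega
  · intro h
    obtain ⟨k, h1, h2, h3, h4⟩ := exists_block β (c := i - 1) (by omega)
    have : i ≠ psum β (k + 1) := fun h' => h ⟨k, h1, h2, h'⟩
    exact ⟨k, h1, h2, by omega, by omega⟩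

lemma dvd_foldr_gcd_iff (l : List ℕ) (d : ℕ) : d ∣ l.foldr Nat.gcd 0 ↔ ∀ a ∈ l, d ∣ a := by
  induction l with
  | nil => simp
  | cons a l ih => simp [Nat.dvd_gcd_iff, ih]

/-- Since `2 = β_p - (β_p - 2)`, the number `gcd(β_k, β_p - 2)` is `gcd(β_1, ..., β_p, 2)`. -/
lemma gcdB_nsmul_eq_zero_iff {Q : Type*} [AddCommGroup Q] (h : 2 ≤ part β β.length) {ζ : Q} :
    gcdB β • ζ = 0 ↔ 2 • ζ = 0 ∧ ∀ k, 1 ≤ k → k ≤ β.length → part β k • ζ = 0 := by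
  have hlen : 1 ≤ β.length := by
    by_contra h'
    rw [part, List.getD_eq_default _ _ (by omega)] at h
    omega
  simp only [← addOrderOf_dvd_iff_nsmul_eq_zero, gcdB, Nat.dvd_gcd_iff, dvd_foldr_gcd_iff]
  constructor
  · rintro ⟨h1, h2⟩
    have h3 := h1 _ (part_mem hlen le_rfl)
    refine ⟨?_, fun k hk hk' => h1 _ (part_mem hk hk')⟩
    have h4 := Nat.dvd_sub h3 h2
    rwa [Nat.sub_sub_self h] at h4
  · rintro ⟨h1, h2⟩
    refine ⟨fun a ha => ?_, Nat.dvd_sub (h2 _ hlen le_rfl) h1⟩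
    obtain ⟨i, hi, rfl⟩ := List.getElem_of_mem ha
    have := h2 (i + 1) (by omega) hi
    rwa [part, Nat.add_sub_cancel, List.getD_eq_getElem _ _ hi] at this

lemma map_eq_zero_of_modSet_wBeta_le (hn : 1 ≤ n) (hβ : ∀ a ∈ β, 1 ≤ a) (hsum : β.sum = n)
    {Q : Type*} [AddCommGroup Q] [Module ℝ Q] (φ : V n →ₗ[ℝ] Q)
    (h : modSet (wBeta n β) ≤ LinearMap.ker (φ.restrictScalars ℤ)) {i : ℕ} (hi : i ∈ J β) :
    φ (simpleCoroot n i) = 0 := by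
  obtain ⟨ζ, h2, hJ, -⟩ := (modSet_wBeta_le_ker_iff hn hβ hsum _).mp h
  rw [← ofNat_smul_eq_nsmul ℝ] at h2
  exact (hJ i hi).trans ((smul_eq_zero.mp h2).resolve_left two_ne_zero)

open Classical in
/-- The basis of `Mod(w_β)` if all parts of `β` are at least `2`. It consists of `α_{n-1}^∨`, up to
the factor `gcd(β_k, β_p - 2)`, and of differences of neighbouring elements of `J_β`. -/
theorem isZBasis_wBeta_of_two_le (hn : 2 ≤ n) (hβ : IsDecPartition β) (hsum : β.sum = n)
    (hp : 2 ≤ part β β.length) :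
    IsZBasis
      ({v | ∃ i ∈ J β \ shift (IBeta β), v = simpleCoroot n i - simpleCoroot n (i + 1)} ∪
        {v | ∃ i ∈ shift (IBeta β) \ {n - 1}, v = simpleCoroot n i - simpleCoroot n (i + 2)} ∪
        {gcdB β • simpleCoroot n (n - 1)})
      (modSet (wBeta n β)) := by
  have hlen : 1 ≤ β.length := by
    rcases β with _ | ⟨a, l⟩
    · rw [List.sum_nil] at hsum; omega
    · simp
  have hI2 : ∀ i ∈ IBeta β, 2 ≤ i ∧ i ≤ n := by
    intro i hi
    obtain ⟨k, h1, h2, rfl⟩ := (mem_IBeta_iff hlen).mp hi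
    have := hβ.le_part h1 h2
    have := psum_succ β h1
    have := psum_succ_le_sum β h2
    exact ⟨by omega, by omega⟩
  have hsh : ∀ {i}, i ∈ shift (IBeta β) ↔ i + 1 ∈ IBeta β :=
    mem_shift_iff fun i hi => by have := hI2 i hi; omega
  have hgap : ∀ i, i ∈ IBeta β → i + 1 ∉ IBeta β := by
    intro i hi hi'
    obtain ⟨j, h1, h2, rfl⟩ := (mem_IBeta_iff hlen).mp hi
    obtain ⟨k, h3, h4, h5⟩ := (mem_IBeta_iff hlen).mp hi'
    rcases Nat.lt_or_ge j k with h | h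
    · have := psum_mono β (show j + 1 ≤ k from h)
      have := hβ.le_part h3 h4
      have := psum_succ β h3
      omega
    · have := psum_mono β (show k + 1 ≤ j + 1 by omega)
      omega
  have hnI : n ∈ IBeta β := Or.inr hsum.symm
  have hnI' : n - 1 ∉ IBeta β := fun h => hgap (n - 1) h (by
    rwa [Nat.sub_add_cancel (by omega)])
  have hJsub := J_subset hβ.2 hsum
  have hJ : ∀ {i}, 1 ≤ i → i ≤ n → (i ∈ J β ↔ i ∉ IBeta β) := fun h1 h2 =>
    mem_J_iff_notMem_IBeta hβ.2 hsum ⟨h1, h2⟩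
  have hnJ : n - 1 ∈ J β := (hJ (by omega) (by omega)).mpr hnI'
  have hi2 : ∀ i, i + 1 ∈ IBeta β → i ≠ n - 1 → i ∈ J β ∧ i + 2 ∈ J β := by
    intro i hi hi'
    have h3 := hI2 _ hi
    exact ⟨(hJ (by omega) (by omega)).mpr fun h => hgap i h hi,
      (hJ (by omega) (by omega)).mpr (hgap (i + 1) hi)⟩
  refine isZBasis_of_forall_map (by omega) (I := J β)
    (fun i hi => ⟨(hJsub i hi).1, (hJsub i hi).2.le⟩)
    (fun i => if i = n - 1 then gcdB β • simpleCoroot n (n - 1)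
      else if i + 1 ∈ IBeta β then simpleCoroot n i - simpleCoroot n (i + 2)
      else simpleCoroot n i - simpleCoroot n (i + 1)) ?_ (fun Q _ φ => ?_)
    fun Q _ _ φ h i hi => map_eq_zero_of_modSet_wBeta_le (by omega) hβ.2 hsum φ h hi
  · rintro v ((⟨i, ⟨hi, hi'⟩, rfl⟩ | ⟨i, ⟨hi, hi'⟩, rfl⟩) | rfl)
    · rw [hsh] at hi'
      have h3 : i ≠ n - 1 := fun h => hi' (by rwa [h, Nat.sub_add_cancel (by omega)])
      exact ⟨i, hi, by simp only [if_neg h3, if_neg hi']⟩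
    · rw [hsh] at hi
      exact ⟨i, (hi2 i hi hi').1, by
        simp only [if_neg (show i ≠ n - 1 from hi'), if_pos hi]⟩
    · exact ⟨n - 1, hnJ, by simp only [if_true]⟩
  · rw [modSet_wBeta_le_ker_iff (by omega) hβ.2 hsum]
    constructor
    · intro h
      have h1 : gcdB β • φ (simpleCoroot n (n - 1)) = 0 := by
        rw [← map_nsmul]; exact h _ (Or.inr rfl)
      obtain ⟨h2, hk⟩ := (gcdB_nsmul_eq_zero_iff hp).mp h1
      refine ⟨_, h2, fun i hi => ?_, hk⟩
      obtain ⟨hi1, hi2⟩ := hJsub i hi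
      refine eq_of_chain (A := fun i => φ (simpleCoroot n i)) hnI'
        (fun i _ hi' => hgap (i + 1) hi') (fun i hi1 hi2 hi3 hi4 => ?_)
        (fun i hi1 hi2 hi3 hi4 => ?_) hi1 (by omega) ((hJ hi1 hi2.le).mp hi)
      · have := h (simpleCoroot n i - simpleCoroot n (i + 1)) (Or.inl (Or.inl
          ⟨i, ⟨(hJ hi1 (by omega)).mpr hi3, by rwa [hsh]⟩, rfl⟩))
        rw [map_sub] at this
        exact sub_eq_zero.mp this
      · have := h (simpleCoroot n i - simpleCoroot n (i + 2)) (Or.inl (Or.inr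
          ⟨i, ⟨hsh.mpr hi4, show i ≠ n - 1 by omega⟩, rfl⟩))
        rw [map_sub] at this
        exact sub_eq_zero.mp this
    · rintro ⟨ζ, h2, hζ, hk⟩
      rintro v ((⟨i, ⟨hi, hi'⟩, rfl⟩ | ⟨i, ⟨hi, hi'⟩, rfl⟩) | rfl)
      · rw [hsh] at hi'
        have h3 := hJsub i hi
        rw [map_sub, hζ i hi, hζ (i + 1) ((hJ (by omega) h3.2).mpr hi'), sub_self]
      · rw [hsh] at hi
        rw [map_sub, hζ i (hi2 i hi hi').1, hζ (i + 2) (hi2 i hi hi').2, sub_self]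
      · rw [map_nsmul, hζ _ hnJ]
        exact (gcdB_nsmul_eq_zero_iff hp).mpr ⟨h2, hk⟩

/-- The basis of `Mod(w_β)` if no `ζ ≠ 0` is annihilated by `2` and by all parts of `β`. -/
theorem isZBasis_wBeta_of_gcd_eq_one (hn : 1 ≤ n) (hβ : IsDecPartition β) (hsum : β.sum = n)
    (h : part β β.length = 1 ∨ (2 ≤ part β β.length ∧ gcdB β = 1)) :
    IsZBasis {v | ∃ j ∈ J β, v = simpleCoroot n j} (modSet (wBeta n β)) := by
  have hJsub := J_subset hβ.2 hsum
  have hlen : 1 ≤ β.length := by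
    rcases β with _ | ⟨a, l⟩
    · rw [List.sum_nil] at hsum; omega
    · simp
  refine isZBasis_of_forall_map hn (I := J β)
    (fun i hi => ⟨(hJsub i hi).1, (hJsub i hi).2.le⟩) (simpleCoroot n) ?_ (fun Q _ φ => ?_)
    fun Q _ _ φ h i hi => map_eq_zero_of_modSet_wBeta_le hn hβ.2 hsum φ h hi
  · rintro v ⟨i, hi, rfl⟩
    exact ⟨i, hi, rfl⟩
  · rw [modSet_wBeta_le_ker_iff hn hβ.2 hsum]
    constructor
    · exact fun h => ⟨0, smul_zero _, fun i hi => h _ ⟨i, hi, rfl⟩, fun _ _ _ => smul_zero _⟩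
    · rintro ⟨ζ, h2, hζ, hk⟩
      have hζ0 : ζ = 0 := by
        rcases h with h | ⟨hp, h⟩
        · rw [← one_nsmul ζ, ← h]
          exact hk _ hlen le_rfl
        · rw [← one_nsmul ζ, ← h]
          exact (gcdB_nsmul_eq_zero_iff hp).mpr ⟨h2, hk⟩
      rintro v ⟨j, hj, rfl⟩
      rw [hζ j hj, hζ0]

end Beta

end TypeB

end

theorem theorem6p2 (n : ℕ) (hn : 2 ≤ n) (β γ : List ℕ)
    (hβ : TypeB.IsDecPartition β) (hγ : TypeB.IsIncPartition γ) (hsum : β.sum + γ.sum = n) :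
    -- case `|β| = 0`, `γ_1 ≥ 3`
    (β.sum = 0 → 3 ≤ TypeB.part γ 1 →
      TypeB.IsZBasis
        ({v | ∃ k, 2 ≤ k ∧ k ≤ γ.length ∧
            v = 2 • TypeB.simpleCoroot n (n - TypeB.psum γ k) +
              TypeB.jump γ k •
                TypeB.simpleCoroot n (if Odd (TypeB.part γ 1) then n else n - 1)} ∪
          {2 • TypeB.simpleCoroot n (n - 1),
            (TypeB.part γ 1 % 2) • TypeB.simpleCoroot n (n - 1) + TypeB.simpleCoroot n n} ∪
          {v | ∃ i ∈ Set.Icc 1 n, i ∉ TypeB.IGamma n γ ∪ TypeB.shift (TypeB.IGamma n γ) ∧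
            v = -TypeB.simpleCoroot n i + TypeB.simpleCoroot n (i + 1)} ∪
          {v | ∃ i ∈ TypeB.shift (TypeB.IGamma n γ), i ≠ n - 1 ∧
            v = -TypeB.simpleCoroot n i + TypeB.simpleCoroot n (i + 2)})
        (TypeB.modSet (TypeB.wRep n β γ))) ∧
    -- case `|β| = 0`, `γ_1 = 2`
    (β.sum = 0 → TypeB.part γ 1 = 2 →
      TypeB.IsZBasis
        ({v | ∃ k, 2 ≤ k ∧ k ≤ γ.length ∧
            v = 2 • TypeB.simpleCoroot n (n - TypeB.psum γ k) +
              TypeB.jump γ k • TypeB.simpleCoroot n (n - 1)} ∪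
          {2 • TypeB.simpleCoroot n (n - 1),
            (TypeB.part γ 1 % 2) • TypeB.simpleCoroot n (n - 1) + TypeB.simpleCoroot n n} ∪
          {v | ∃ i ∈ Set.Icc 1 n, i ∉ TypeB.IGamma n γ ∪ TypeB.shift (TypeB.IGamma n γ) ∧
            v = -TypeB.simpleCoroot n i + TypeB.simpleCoroot n (i + 1)} ∪
          {v | ∃ i ∈ TypeB.shift (TypeB.IGamma n γ), i ≠ n - 1 ∧
            v = -TypeB.simpleCoroot n i + TypeB.simpleCoroot n (i + 2)})
        (TypeB.modSet (TypeB.wRep n β γ))) ∧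
    -- case `|β| = 0`, `γ_1 = 1`, `γ_2 ≥ 2`
    (β.sum = 0 → TypeB.part γ 1 = 1 → 2 ≤ TypeB.part γ 2 →
      TypeB.IsZBasis
        ({v | ∃ k, 1 ≤ k ∧ k ≤ γ.length ∧
            v = 2 • TypeB.simpleCoroot n (n - TypeB.psum γ k) +
              TypeB.jump γ k • TypeB.simpleCoroot n n} ∪
          {v | ∃ i ∈ Set.Icc 1 n, i ∉ TypeB.IGamma n γ ∪ TypeB.shift (TypeB.IGamma n γ) ∧
            v = -TypeB.simpleCoroot n i + TypeB.simpleCoroot n (i + 1)} ∪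
          {v | ∃ i ∈ TypeB.shift (TypeB.IGamma n γ), i ≠ n - 1 ∧
            v = -TypeB.simpleCoroot n i + TypeB.simpleCoroot n (i + 2)})
        (TypeB.modSet (TypeB.wRep n β γ))) ∧
    -- case `|β| = 0`, `γ_1 = ⋯ = γ_ℓ = 1` with `2 ≤ ℓ < n`, and `γ_{ℓ+1} ≥ 2`
    (∀ ℓ : ℕ, β.sum = 0 → 2 ≤ ℓ → ℓ < n →
      (∀ k, 1 ≤ k → k ≤ ℓ → TypeB.part γ k = 1) → 2 ≤ TypeB.part γ (ℓ + 1) →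
      TypeB.IsZBasis
        ({v | ∃ k, 1 ≤ k ∧ k ≤ γ.length ∧
            v = 2 • TypeB.simpleCoroot n (n - TypeB.psum γ k) +
              TypeB.jump γ k • TypeB.simpleCoroot n n} ∪
          {-TypeB.simpleCoroot n (n - ℓ - 1) + TypeB.simpleCoroot n n} ∪
          {v | ∃ i ∈ Set.Icc 1 n, i ∉ TypeB.IGamma n γ ∪ TypeB.shift (TypeB.IGamma n γ) ∧
            v = -TypeB.simpleCoroot n i + TypeB.simpleCoroot n (i + 1)} ∪
          {v | ∃ i ∈ TypeB.shift (TypeB.IGamma n γ), i < n - ℓ - 1 ∧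
            v = -TypeB.simpleCoroot n i + TypeB.simpleCoroot n (i + 2)})
        (TypeB.modSet (TypeB.wRep n β γ))) ∧
    -- case `|β| = 0`, `γ = (1, ..., 1)`
    (β.sum = 0 → γ = List.replicate n 1 →
      TypeB.IsZBasis
        {v | ∃ i ∈ Set.Icc 1 n, v = 2 • TypeB.simpleCoroot n i}
        (TypeB.modSet (TypeB.wRep n β γ))) ∧
    -- case `|γ| = 0`, `β_p ≥ 2`, `gcd(β_k, β_p - 2) ≥ 2`
    (γ.sum = 0 → 2 ≤ TypeB.part β β.length → 2 ≤ TypeB.gcdB β →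
      TypeB.IsZBasis
        ({v | ∃ i ∈ TypeB.J β \ TypeB.shift (TypeB.IBeta β),
            v = TypeB.simpleCoroot n i - TypeB.simpleCoroot n (i + 1)} ∪
          {v | ∃ i ∈ TypeB.shift (TypeB.IBeta β) \ {n - 1},
            v = TypeB.simpleCoroot n i - TypeB.simpleCoroot n (i + 2)} ∪
          {TypeB.gcdB β • TypeB.simpleCoroot n (n - 1)})
        (TypeB.modSet (TypeB.wRep n β γ))) ∧
    -- case `|γ| = 0`, and either `β_p = 1`, or `β_p ≥ 2` and `gcd(β_k, β_p - 2) = 1`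
    (γ.sum = 0 →
      (TypeB.part β β.length = 1 ∨ (2 ≤ TypeB.part β β.length ∧ TypeB.gcdB β = 1)) →
      TypeB.IsZBasis
        {v | ∃ j ∈ TypeB.J β, v = TypeB.simpleCoroot n j}
        (TypeB.modSet (TypeB.wRep n β γ))) := by
  have h0 : ∀ {l : List ℕ}, (∀ a ∈ l, 1 ≤ a) → l.sum = 0 → l = [] := TypeB.eq_nil_of_sum_eq_zero
  refine ⟨fun hβ0 h1 => ?_, fun hβ0 h1 => ?_, fun hβ0 h1 h2 => ?_, fun l hβ0 hl _ h1 h2 => ?_,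
    fun hβ0 h1 => ?_, fun hγ0 h1 _ => ?_, fun hγ0 h1 => ?_⟩
  · rw [h0 hβ.2 hβ0, TypeB.wRep_nil_left]
    exact TypeB.isZBasis_wGamma_of_two_le hn hγ (by omega) (by omega) (by congr)
  · rw [h0 hβ.2 hβ0, TypeB.wRep_nil_left]
    exact TypeB.isZBasis_wGamma_of_two_le hn hγ (by omega) h1.ge
      (if_neg (by rw [h1]; decide)).symm
  · rw [h0 hβ.2 hβ0, TypeB.wRep_nil_left]
    have hsum' : γ.sum = n := by omega
    have hones : ∀ k, 1 ≤ k → k ≤ 1 → TypeB.part γ k = 1 := fun k hk hk' => by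
      rwa [le_antisymm hk' hk]
    have hlen : 2 ≤ γ.length := TypeB.le_length_of_one_le_part (by omega) (by omega)
    have hp2 : TypeB.psum γ 2 = 1 :=
      TypeB.psum_eq_of_part_eq_one hones (k := 2) (by omega) le_rfl
    have hle := TypeB.psum_succ_le_sum γ hlen
    have hs := TypeB.psum_succ γ (k := 2) (by omega)
    have hsub := TypeB.IGamma_subset hγ.2 hsum'
    have hsh : ∀ {i}, i ∈ TypeB.shift (TypeB.IGamma n γ) ↔ i + 1 ∈ TypeB.IGamma n γ :=
      TypeB.mem_shift_iff fun i hi => (hsub hi).1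
    -- the index `i = n - 2` of the last family gives the extra vector of the case `ℓ = 1`
    convert TypeB.isZBasis_wGamma_of_ones hγ hsum' le_rfl hones h2 using 1
    ext v
    constructor
    · rintro ((h | h) | ⟨i, hi, hi', rfl⟩)
      · exact Or.inl (Or.inl (Or.inl h))
      · exact Or.inl (Or.inr h)
      · have h3 := (hsub (hsh.mp hi)).2
        rcases (show i ≤ n - 1 - 1 by omega).eq_or_lt with rfl | h4
        · refine Or.inl (Or.inl (Or.inr ?_))
          rw [show n - 1 - 1 + 2 = n by omega]
          rfl
        · exact Or.inr ⟨i, hi, h4, rfl⟩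
    · rintro (((h | rfl) | h) | ⟨i, hi, hi', rfl⟩)
      · exact Or.inl (Or.inl h)
      · refine Or.inr ⟨n - 1 - 1, hsh.mpr ⟨2, by omega, hlen, by omega⟩, by omega, ?_⟩
        rw [show n - 1 - 1 + 2 = n by omega]
      · exact Or.inl (Or.inr h)
      · exact Or.inr ⟨i, hi, by omega, rfl⟩
  · rw [h0 hβ.2 hβ0, TypeB.wRep_nil_left]
    exact TypeB.isZBasis_wGamma_of_ones hγ (by omega) (by omega) h1 h2
  · rw [h0 hβ.2 hβ0, TypeB.wRep_nil_left, h1]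
    exact TypeB.isZBasis_wGamma_replicate_one (by omega)
  · rw [h0 hγ.2 hγ0, TypeB.wRep_nil_right]
    exact TypeB.isZBasis_wBeta_of_two_le hn hβ (by omega) h1
  · rw [h0 hγ.2 hγ0, TypeB.wRep_nil_right]
    exact TypeB.isZBasis_wBeta_of_gcd_eq_one (by omega) hβ (by omega) h1
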